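/- Let $G$ be a compact Lie group whose Lie algebra $\mathfrak g$ is simple, and let $K<G$ be a compact Lie subgroup whose Lie algebra $\mathfrak k=\mathfrak k_1$ is simple. Let $Q$ be the negative of the Killing form of $\mathfrak g$, let $\mathfrak a$ be the $Q$-orthogonal complement of $\mathfrak k_1$ in $\mathfrak g$, and assume that $\mathrm{Ad}(K)$ acts irreducibly on $\mathfrak a$ (in particular $\mathfrak a\neq 0$). Put $n=\dim\mathfrak a$ and $d_1=\dim\mathfrak k_1$. There is a constant $\kappa_1$ such that the Killing form $B_1$ of $\mathfrak k_1$ equals $-\kappa_1 Q|_{\mathfrak k_1}$, and with this constant the following holds. Identify left-invariant symmetric $(0,2)$-tensor fields on $G$ with symmetric bilinear forms on $\mathfrak g$, and let $\mathcal M_K$ be the set of left-invariant Riemannian metrics on $G$ of the form $$\alpha\, Q|_{\mathfrak a}+\alpha_1\, Q|_{\mathfrak k_1},\qquad \alpha,\alpha_1>0.$$ Let $T=T_{\mathfrak a}Q|_{\mathfrak a}+T_1Q|_{\mathfrak k_1}\in\mathcal M_K$, with $T_{\mathfrak a},T_1>0$. Then there exist a metric $g\in\mathcal M_K$ and a constant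 $c>0$ with $\mathrm{Ric}_g=cT$ if and only if $$(2d_1(1-\kappa_1)+n)\,T_1>n\,T_{\mathfrak a}\,\kappa_1 .$$ When such a metric exists, it is unique up to scaling: if $g,g'\in\mathcal M_K$ satisfy $\mathrm{Ric}_g=cT$ and $\mathrm{Ric}_{g'}=c'T$ with $c,c'>0$, then $g'=sg$ for some $s>0$. -/

import Mathlib

open scoped Manifold ContDiff
open VectorField

noncomputable section

namespace RicciLie

/-- Over `ℝ` the smoothness `minSmoothness ℝ 3` that the bracket on the Lie algebra of a Lie group
asks for is at most `∞`. -/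
instance instLEInftyMinSmoothness : ENat.LEInfty (minSmoothness ℝ 3) :=
  ⟨by
    rw [minSmoothness_of_isRCLikeNormedField]
    exact ENat.LEInfty.out⟩

section LieGroupNotions

variable {m : ℕ} {G : Type*} [TopologicalSpace G] [ChartedSpace (EuclideanSpace ℝ (Fin m)) G]
  [Group G]

instance instFiniteTangent (x : G) : Module.Finite ℝ (TangentSpace (𝓡 m) x) :=
  inferInstanceAs (Module.Finite ℝ (EuclideanSpace ℝ (Fin m)))

/-- Left translation of a tangent vector at `x` back to the identity:
`v ↦ d(L_{x⁻¹})_x v ∈ 𝔤`. -/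
def toLie (x : G) (v : TangentSpace (𝓡 m) x) : GroupLieAlgebra (𝓡 m) G :=
  (mfderiv (𝓡 m) (𝓡 m) (fun y : G => x⁻¹ * y) x v : EuclideanSpace ℝ (Fin m))

/-- The adjoint action `Ad(k) : 𝔤 → 𝔤`, the differential at the identity of `x ↦ k x k⁻¹`. -/
def Ad (k : G) (X : GroupLieAlgebra (𝓡 m) G) : GroupLieAlgebra (𝓡 m) G :=
  (mfderiv (𝓡 m) (𝓡 m) (fun y : G => k * y * k⁻¹) 1 X : EuclideanSpace ℝ (Fin m))

/-- `Ad(K)` acts irreducibly on the subspace `V` of `𝔤`: `V` is non-zero, and a subspace of `V`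
that is invariant under all `Ad(k)`, `k ∈ K`, is zero or `V`. -/
def AdIrreducible (K : Subgroup G) (V : Submodule ℝ (GroupLieAlgebra (𝓡 m) G)) : Prop :=
  V ≠ ⊥ ∧ ∀ W : Submodule ℝ (GroupLieAlgebra (𝓡 m) G), W ≤ V →
    (∀ k ∈ K, ∀ X ∈ W, Ad k X ∈ W) → W = ⊥ ∨ W = V

/-- The left-invariant `(0,2)`-tensor field on `G` determined by a bilinear form on `𝔤`. -/
def leftInvariantTensor (b : LinearMap.BilinForm ℝ (GroupLieAlgebra (𝓡 m) G)) (x : G)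
    (v w : TangentSpace (𝓡 m) x) : ℝ :=
  b (toLie x v) (toLie x w)

/-- The derivative of a function along a vector field. -/
def dirDeriv (X : ∀ x : G, TangentSpace (𝓡 m) x) (f : G → ℝ) (x : G) : ℝ :=
  (mfderiv (𝓡 m) 𝓘(ℝ, ℝ) f x (X x) : ℝ)

/-- The right-hand side of the Koszul formula for a metric `g` and vector fields `X`, `Y`, `Z`:
`X g(Y,Z) + Y g(X,Z) - Z g(X,Y) + g([X,Y],Z) - g([X,Z],Y) - g([Y,Z],X)`. -/
def koszul (g : ∀ x : G, TangentSpace (𝓡 m) x → TangentSpace (𝓡 m) x → ℝ)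
    (X Y Z : ∀ x : G, TangentSpace (𝓡 m) x) (x : G) : ℝ :=
  dirDeriv X (fun y => g y (Y y) (Z y)) x + dirDeriv Y (fun y => g y (X y) (Z y)) x
    - dirDeriv Z (fun y => g y (X y) (Y y)) x
    + g x (mlieBracket (𝓡 m) X Y x) (Z x) - g x (mlieBracket (𝓡 m) X Z x) (Y x)
    - g x (mlieBracket (𝓡 m) Y Z x) (X x)

/-- The Levi-Civita covariant derivative `∇_X Y` of a Riemannian metric `g` on a Lie group, given
by the Koszul formula: `∇_X Y` at `x` is the (unique) tangent vector `u` such that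
`2 g(u, Z) = koszul g X Y Z` at `x` for all left-invariant vector fields `Z`
(these span every tangent space). -/
def leviCivita (g : ∀ x : G, TangentSpace (𝓡 m) x → TangentSpace (𝓡 m) x → ℝ)
    (X Y : ∀ x : G, TangentSpace (𝓡 m) x) (x : G) : TangentSpace (𝓡 m) x :=
  Classical.epsilon fun u : TangentSpace (𝓡 m) x =>
    ∀ Z : GroupLieAlgebra (𝓡 m) G,
      2 * g x u (mulInvariantVectorField Z x) = koszul g X Y (mulInvariantVectorField Z) x

/-- The curvature tensor `R(X,Y)Z = ∇_X ∇_Y Z - ∇_Y ∇_X Z - ∇_{[X,Y]} Z`. -/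
def curvature (g : ∀ x : G, TangentSpace (𝓡 m) x → TangentSpace (𝓡 m) x → ℝ)
    (X Y Z : ∀ x : G, TangentSpace (𝓡 m) x) (x : G) : TangentSpace (𝓡 m) x :=
  leviCivita g X (leviCivita g Y Z) x - leviCivita g Y (leviCivita g X Z) x
    - leviCivita g (mlieBracket (𝓡 m) X Y) Z x

/-- The Ricci curvature `Ric_g(v,w)` at `x`: the trace of `u ↦ R(u,v)w` on the tangent space at `x`.
Tangent vectors are extended to left-invariant vector fields (the curvature is a tensor, so the
extension is irrelevant), and the trace is taken in a left-invariant frame. -/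
def ricci (g : ∀ x : G, TangentSpace (𝓡 m) x → TangentSpace (𝓡 m) x → ℝ) (x : G)
    (v w : TangentSpace (𝓡 m) x) : ℝ :=
  let e := Module.finBasis ℝ (GroupLieAlgebra (𝓡 m) G)
  ∑ i, e.coord i (toLie x
    (curvature g (mulInvariantVectorField (e i)) (mulInvariantVectorField (toLie x v))
      (mulInvariantVectorField (toLie x w)) x))

/-- `Ric_g = c T` as tensor fields on `G`, for some constant `c > 0`; here `g` and `T` are
left-invariant and given by bilinear forms on `𝔤`. -/
def SolvesPrescribedRicci (g T : LinearMap.BilinForm ℝ (GroupLieAlgebra (𝓡 m) G)) : Prop :=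
  ∃ c : ℝ, 0 < c ∧ ∀ (x : G) (v w : TangentSpace (𝓡 m) x),
    ricci (leftInvariantTensor g) x v w = c * leftInvariantTensor T x v w

end LieGroupNotions

section Subgroup

variable {m l : ℕ} {G : Type*} [TopologicalSpace G] [ChartedSpace (EuclideanSpace ℝ (Fin m)) G]
  [Group G] [LieGroup (𝓡 m) ∞ G]

/-- The background form `Q`: the negative of the Killing form of `𝔤`. -/
def Q : LinearMap.BilinForm ℝ (GroupLieAlgebra (𝓡 m) G) :=
  -killingForm ℝ (GroupLieAlgebra (𝓡 m) G)

variable (K : Subgroup G) [ChartedSpace (EuclideanSpace ℝ (Fin l)) K]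

/-- The differential at the identity of the inclusion of `K` in `G`, a map `Lie(K) → 𝔤`. -/
def inclLie : GroupLieAlgebra (𝓡 l) K →ₗ[ℝ] GroupLieAlgebra (𝓡 m) G :=
  (mfderiv (𝓡 l) (𝓡 m) (fun k : K => (k : G)) 1).toLinearMap

/-- The Lie algebra `𝔨` of `K` as a subspace of `𝔤`. -/
def kSub : Submodule ℝ (GroupLieAlgebra (𝓡 m) G) :=
  LinearMap.range (inclLie K (m := m) (l := l))

/-- The `Q`-orthogonal complement `𝔞` of `𝔨` in `𝔤`. -/
def aSub : Submodule ℝ (GroupLieAlgebra (𝓡 m) G) :=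
  Q.orthogonal (kSub K (m := m) (l := l))

/-- `b = α Q|_𝔞 + α₁ Q|_𝔨` with respect to the decomposition `𝔤 = 𝔞 ⊕ 𝔨`. -/
structure IsDiagonal (b : LinearMap.BilinForm ℝ (GroupLieAlgebra (𝓡 m) G)) (α α₁ : ℝ) : Prop where
  on_a : ∀ X ∈ aSub K (m := m) (l := l), ∀ Y ∈ aSub K (m := m) (l := l), b X Y = α * Q X Y
  on_k : ∀ X ∈ kSub K (m := m) (l := l), ∀ Y ∈ kSub K (m := m) (l := l), b X Y = α₁ * Q X Y
  a_k : ∀ X ∈ aSub K (m := m) (l := l), ∀ Y ∈ kSub K (m := m) (l := l), b X Y = 0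
  k_a : ∀ X ∈ kSub K (m := m) (l := l), ∀ Y ∈ aSub K (m := m) (l := l), b X Y = 0

/-- The set `𝓜_K` for `K` with simple Lie algebra: the left-invariant metrics
`α Q|_𝔞 + α₁ Q|_𝔨` with `α, α₁ > 0`, each given by the inner product it induces on `𝔤`. -/
def metricsMK : Set (LinearMap.BilinForm ℝ (GroupLieAlgebra (𝓡 m) G)) :=
  {g | ∃ α α₁ : ℝ, 0 < α ∧ 0 < α₁ ∧ IsDiagonal K (m := m) (l := l) g α α₁}

end Subgroup

end RicciLie

end

/-! Write a metric as `α Q|_𝔞 + α₁ Q|_𝔨` and put x = α₁/α. Compactness of G gives an Ad-invariant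
inner product on 𝔤 by averaging, so Q is positive definite. On left-invariant fields the Koszul
formula gives ∇_X Y = ½[X, Y] + s([X_𝔞, Y_𝔨] - [X_𝔨, Y_𝔞]) with 2s + 1 = x (`connection_koszul`).
With L_w : v ↦ -∇_v w, the traces of all L_w vanish and the Ricci form is -tr(L_v L_w)
(`sum_coord_connectionCurvature`).

Let p be the Q-orthogonal projection onto 𝔨. The form tr(p ad v ad w) is κ times the Killing form on
𝔨, where it is the Killing form of 𝔨. On 𝔞 it is A times the Killing form for some constant A, by
Schur's lemma (`exists_casimir`). Counting one double sum in two ways gives A n = (1 - κ) d₁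
(`casimir_mul_finrank`). Simplicity of 𝔤 forces κ < 1, hence A > 0. Then
(`IsSubalgebraProj.neg_trace_connectionOp`) Ric = ¼(κ + x²(1 - κ)) Q on 𝔨, Ric = ¼(1 + 2A - 2Ax) Q
on 𝔞, and 𝔨, 𝔞 are Ric-orthogonal.

Eliminating c leaves T_𝔞(κ + x²(1 - κ)) = T₁(1 + 2A - 2Ax). The left side increases and the right
side decreases for x > 0, so there is at most one root, and a root exists exactly when the left side
is smaller at x = 0: T_𝔞 κ < T₁(1 + 2A). Multiplying by n gives the stated inequality, and
uniqueness of x is uniqueness of the metric up to scaling.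

The algebra needs some Lie theory: the derivative of Ad at the identity is the bracket. This makes
Ad(k) and the inclusion of Lie(K) compatible with brackets, and turns Ad-invariance of forms into
ad-invariance. -/

namespace RicciLie

/-! ### Inner products, orthonormal frames and traces. -/

section BilinearAlgebra

variable {V : Type*} [AddCommGroup V] [Module ℝ V]

/-- A symmetric, positive definite bilinear form. -/
structure IsInner (B : LinearMap.BilinForm ℝ V) : Prop where
  symm : ∀ x y, B x y = B y x
  pos : ∀ x, x ≠ 0 → 0 < B x x

namespace IsInner

variable {B : LinearMap.BilinForm ℝ V}

lemma nonneg (hB : IsInner B) (x : V) : 0 ≤ B x x := by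
  by_cases h : x = 0
  · simp [h]
  · exact (hB.pos x h).le

lemma eq_zero (hB : IsInner B) {x : V} (h : B x x ≤ 0) : x = 0 := by
  by_contra hx
  exact absurd (hB.pos x hx) (not_lt.mpr h)

lemma comp (hB : IsInner B) {W : Type*} [AddCommGroup W] [Module ℝ W] (f : W →ₗ[ℝ] V)
    (hf : Function.Injective f) : IsInner (B.compl₁₂ f f) where
  symm x y := hB.symm _ _
  pos x hx := hB.pos _ fun h => hx (hf (by simpa using h))

/-- The inner product space structure given by a positive definite form. -/
abbrev core (hB : IsInner B) : InnerProductSpace.Core ℝ V where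
  inner x y := B x y
  conj_inner_symm x y := by simp [hB.symm x y]
  re_inner_nonneg x := by simpa using hB.nonneg x
  add_left x y z := by simp
  smul_left x y r := by simp
  definite x h := hB.eq_zero (le_of_eq h)

/-- A positive definite form on a finite-dimensional space has an orthonormal basis. -/
lemma exists_frame [Module.Finite ℝ V] (hB : IsInner B) :
    ∃ e : Fin (Module.finrank ℝ V) → V, ∀ x, x = ∑ i, B (e i) x • e i := by
  let _ : NormedAddCommGroup V := hB.core.toNormedAddCommGroup
  let _ : InnerProductSpace ℝ V := InnerProductSpace.ofCore hB.core.toCore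
  exact ⟨stdOrthonormalBasis ℝ V, fun x => ((stdOrthonormalBasis ℝ V).sum_repr' x).symm⟩

/-- A symmetric form has an eigenvector with respect to a positive definite form. -/
lemma exists_eigenvector [Module.Finite ℝ V] [Nontrivial V] (hB : IsInner B)
    (τ : LinearMap.BilinForm ℝ V) (hτ : ∀ x y, τ x y = τ y x) :
    ∃ r : ℝ, ∃ v : V, v ≠ 0 ∧ ∀ w, τ v w = r * B v w := by
  obtain ⟨e, he⟩ := hB.exists_frame
  let S : V →ₗ[ℝ] V := ∑ i, (τ (e i)).smulRight (e i)
  have hS : ∀ v w, B (S v) w = τ v w := by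
    intro v w
    have : τ v w = τ v (∑ i, B (e i) w • e i) := by rw [← he w]
    rw [this]
    simp only [S, LinearMap.sum_apply, LinearMap.smulRight_apply, map_sum, map_smul,
      LinearMap.smul_apply, smul_eq_mul]
    exact Finset.sum_congr rfl fun i _ => by rw [hτ v (e i), mul_comm]
  let _ : NormedAddCommGroup V := hB.core.toNormedAddCommGroup
  let _ : InnerProductSpace ℝ V := InnerProductSpace.ofCore hB.core.toCore
  have hsym : S.IsSymmetric := fun v w => by
    change B (S v) w = B v (S w)
    rw [hB.symm v, hS, hS, hτ]
  obtain ⟨v, hv⟩ := hsym.hasEigenvalue_iSup_of_finiteDimensional.exists_hasEigenvector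
  obtain ⟨r, hr⟩ : ∃ r : ℝ, S v = r • v := ⟨_, hv.apply_eq_smul⟩
  refine ⟨r, v, hv.2, fun w => ?_⟩
  rw [← hS, hr, map_smul]
  rfl

end IsInner

variable {ι : Type*} [Fintype ι]

/-- The operator `x ↦ ∑ B(eᵢ, x) eᵢ`. -/
def frameProj (B : LinearMap.BilinForm ℝ V) (e : ι → V) : V →ₗ[ℝ] V :=
  ∑ i, (B (e i)).smulRight (e i)

lemma frameProj_apply (B : LinearMap.BilinForm ℝ V) (e : ι → V) (x : V) :
    frameProj B e x = ∑ i, B (e i) x • e i := by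
  simp [frameProj]

/-- The vectors `e i` need not span: for an orthonormal basis of a subspace this computes traces
weighted by the orthogonal projection onto it. -/
lemma trace_frameProj_mul [Module.Finite ℝ V] (B : LinearMap.BilinForm ℝ V) (e : ι → V)
    (T : V →ₗ[ℝ] V) :
    LinearMap.trace ℝ V (frameProj B e * T) = ∑ i, B (e i) (T (e i)) := by
  have : frameProj B e * T = ∑ i, ((B (e i)) ∘ₗ T).smulRight (e i) := by
    ext x; simp [frameProj_apply]
  rw [this, map_sum]
  refine Finset.sum_congr rfl fun i _ => ?_
  rw [LinearMap.trace_smulRight]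
  rfl

lemma trace_eq_sum_frame [Module.Finite ℝ V] {B : LinearMap.BilinForm ℝ V} {e : ι → V}
    (he : ∀ x, x = ∑ i, B (e i) x • e i) (T : V →ₗ[ℝ] V) :
    LinearMap.trace ℝ V T = ∑ i, B (e i) (T (e i)) := by
  have : frameProj B e = 1 := by
    ext x; rw [frameProj_apply, ← he]; rfl
  rw [← trace_frameProj_mul, this, one_mul]

end BilinearAlgebra

/-! ### Invariant forms and the Killing form. -/

section LieAlgebraInner

variable {L : Type*} [LieRing L] [LieAlgebra ℝ L]

open LieAlgebra

/-- Each `ad X` is skew for an invariant form. For X = Y the sum is one of squared lengths, hence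
the sign of the Killing form. -/
lemma killingForm_eq_neg_sum [Module.Finite ℝ L] {ι : Type*} [Fintype ι] {B : LinearMap.BilinForm ℝ L}
    (hinv : ∀ z x y : L, B ⁅z, x⁆ y = -B x ⁅z, y⁆)
    {e : ι → L} (he : ∀ x, x = ∑ i, B (e i) x • e i) (X Y : L) :
    killingForm ℝ L X Y = -∑ i, B ⁅X, e i⁆ ⁅Y, e i⁆ := by
  rw [LieModule.traceForm_apply_apply]
  rw [trace_eq_sum_frame he, ← Finset.sum_neg_distrib]
  exact Finset.sum_congr rfl fun i _ => by simp [hinv]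

/-- A Lie algebra with trivial centre and an invariant inner product has negative definite
Killing form. -/
lemma isInner_neg_killingForm [Module.Finite ℝ L] {B : LinearMap.BilinForm ℝ L} (hB : IsInner B)
    (hinv : ∀ z x y : L, B ⁅z, x⁆ y = -B x ⁅z, y⁆) (hc : ∀ x : L, (∀ y : L, ⁅x, y⁆ = 0) → x = 0) :
    IsInner (-killingForm ℝ L) where
  symm x y := by simp [LieModule.traceForm_comm ℝ L L x y]
  pos x hx := by
    obtain ⟨e, he⟩ := hB.exists_frame
    simp only [LinearMap.neg_apply, killingForm_eq_neg_sum hinv he, neg_neg]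
    by_contra hle
    have h0 : ∑ i, B ⁅x, e i⁆ ⁅x, e i⁆ = 0 :=
      le_antisymm (not_lt.mp hle) (Finset.sum_nonneg fun i _ => hB.nonneg _)
    rw [Finset.sum_eq_zero_iff_of_nonneg fun i _ => hB.nonneg _] at h0
    refine hx (hc x fun y => ?_)
    rw [he y, lie_sum]
    refine Finset.sum_eq_zero fun i hi => ?_
    rw [lie_smul, hB.eq_zero (h0 i hi).le, smul_zero]

lemma center_trivial_of_isSimple [IsSimple ℝ L] (x : L) (h : ∀ y : L, ⁅x, y⁆ = 0) : x = 0 := by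
  have hb : LieAlgebra.center ℝ L = ⊥ := by
    rcases IsSimple.eq_bot_or_eq_top (R := ℝ) (LieAlgebra.center ℝ L) with h | h
    · exact h
    · exact absurd (LieAlgebra.isLieAbelian_iff_center_eq_top ℝ L |>.mpr h)
        (IsSimple.non_abelian ℝ)
  have hx : x ∈ LieAlgebra.center ℝ L := by
    rw [LieModule.mem_maxTrivSubmodule]
    intro y
    rw [← lie_skew, h y, neg_zero]
  rw [hb] at hx
  simpa using hx

/-- Schur's lemma for invariant forms on a simple Lie algebra. -/
lemma exists_eq_smul_of_isSimple [Module.Finite ℝ L] [IsSimple ℝ L] {B τ : LinearMap.BilinForm ℝ L} (hB : IsInner B)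
    (hτ : ∀ x y, τ x y = τ y x) (hBinv : ∀ z x y : L, B ⁅z, x⁆ y = -B x ⁅z, y⁆)
    (hτinv : ∀ z x y : L, τ ⁅z, x⁆ y = -τ x ⁅z, y⁆) : ∃ r : ℝ, ∀ x y, τ x y = r * B x y := by
  have hnt : Nontrivial L := by
    by_contra h
    rw [not_nontrivial_iff_subsingleton] at h
    exact IsSimple.non_abelian ℝ (L := L) ⟨fun x y => Subsingleton.elim _ _⟩
  obtain ⟨r, v, hv, h⟩ := hB.exists_eigenvector τ hτ
  -- Invariance of both forms makes the eigenspace for r an ideal; it contains v ≠ 0, so it is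
  -- everything.
  let I : LieIdeal ℝ L :=
    { carrier := {v | ∀ w, τ v w = r * B v w}
      add_mem' := fun {a b} ha hb w => by simp [ha w, hb w, mul_add]
      zero_mem' := fun w => by simp
      smul_mem' := fun c a ha w => by simp [ha w]; ring
      lie_mem := fun {x a} ha w => by
        rw [hτinv, hBinv, ha]; ring }
  have hI : I = ⊤ := by
    rcases IsSimple.eq_bot_or_eq_top (R := ℝ) I with h' | h'
    · exact absurd (by simpa [h'] using (show v ∈ I from h)) hv
    · exact h'
  refine ⟨r, fun x => ?_⟩
  have : x ∈ I := by simp [hI]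
  exact this

end LieAlgebraInner

/-! ### The projection onto a subalgebra and the Ricci form of a diagonal metric. -/

section ReductivePair

open LieAlgebra

variable {L : Type*} [LieRing L] [LieAlgebra ℝ L]

lemma neg_killingForm_lie (z x y : L) :
    (-killingForm ℝ L) ⁅z, x⁆ y = -(-killingForm ℝ L) x ⁅z, y⁆ := by
  rw [LinearMap.neg_apply, LinearMap.neg_apply, LinearMap.neg_apply, LinearMap.neg_apply,
    ← lie_skew, map_neg, LinearMap.neg_apply, LieModule.traceForm_apply_lie_apply]

/-- `p` is the orthogonal projection, for minus the Killing form, onto a subalgebra. -/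
structure IsSubalgebraProj (p : Module.End ℝ L) : Prop where
  inner : IsInner (-killingForm ℝ L)
  idem : ∀ x, p (p x) = p x
  selfAdjoint : ∀ x y, (-killingForm ℝ L) (p x) y = (-killingForm ℝ L) x (p y)
  lie_mem : ∀ x y, p ⁅p x, p y⁆ = ⁅p x, p y⁆

/-- With `p` the projection on `𝔨` and `X, Y` in `𝔤 = 𝔞 ⊕ 𝔨`, the Levi-Civita connection
`∇_X Y = ½ [X, Y] + s ([X_𝔞, Y_𝔨] - [X_𝔨, Y_𝔞])` of the metric `α Q|_𝔞 + α₁ Q|_𝔨`, where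
`2 s + 1 = α₁ / α`. -/
noncomputable def connection (p : Module.End ℝ L) (s : ℝ) (X Y : L) : L :=
  (1 / 2 : ℝ) • ⁅X, Y⁆ + s • (⁅X - p X, p Y⁆ - ⁅p X, Y - p Y⁆)

/-- The operator `v ↦ -∇_v w`. -/
noncomputable def connectionOp (p : Module.End ℝ L) (s : ℝ) (w : L) : Module.End ℝ L :=
  (1 / 2 : ℝ) • ad ℝ L w + s • ad ℝ L (p w) - s • (ad ℝ L w * p)

lemma connection_eq_neg_connectionOp (p : Module.End ℝ L) (s : ℝ) (X Y : L) :
    connection p s X Y = -connectionOp p s Y X := by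
  simp only [connection, connectionOp, LinearMap.sub_apply, LinearMap.add_apply,
    LinearMap.smul_apply, ad_apply, Module.End.mul_apply, sub_lie, lie_sub]
  rw [← lie_skew X Y, ← lie_skew X (p Y), ← lie_skew (p X) (p Y), ← lie_skew (p X) Y]
  module

lemma connectionOp_add (p : Module.End ℝ L) (s : ℝ) (v w : L) :
    connectionOp p s (v + w) = connectionOp p s v + connectionOp p s w := by
  simp only [connectionOp, map_add, add_mul]
  module

/-- Torsion-freeness. It turns ∇_v Y into `⁅v, Y⁆ - connectionOp p s v Y` in the curvature
computation. -/
lemma connection_sub_comm (p : Module.End ℝ L) (s : ℝ) (X Y : L) :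
    connection p s X Y - connection p s Y X = ⁅X, Y⁆ := by
  simp only [connection, sub_lie, lie_sub]
  rw [← lie_skew Y X, ← lie_skew Y (p X), ← lie_skew (p Y) (p X), ← lie_skew (p Y) X]
  module

namespace IsSubalgebraProj

variable {p : Module.End ℝ L}

/-- For z in 𝔨, `ad z` preserves 𝔨 and is skew for the Killing form, so it preserves the complement
𝔞 as well. -/
lemma lie_proj (hp : IsSubalgebraProj p) (x y : L) : p ⁅p x, y⁆ = ⁅p x, p y⁆ := by
  have h : p ⁅p x, y - p y⁆ = 0 := by
    apply hp.inner.eq_zero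
    rw [hp.selfAdjoint, hp.idem, neg_killingForm_lie, ← hp.lie_mem, ← hp.selfAdjoint, map_sub,
      hp.idem, sub_self, map_zero, LinearMap.zero_apply, neg_zero]
  rw [lie_sub, map_sub, hp.lie_mem, sub_eq_zero] at h
  exact h

lemma proj_mul_ad (hp : IsSubalgebraProj p) {v : L} (hv : p v = v) : p * ad ℝ L v = ad ℝ L v * p := by
  ext y
  have := hp.lie_proj v y
  rw [hv] at this
  exact this

/-- This is [𝔞, 𝔨] ⊆ 𝔞. -/
lemma proj_mul_ad_mul_proj (hp : IsSubalgebraProj p) {v : L} (hv : p v = 0) : p * ad ℝ L v * p = 0 := by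
  ext y
  have := hp.lie_proj y v
  rw [hv, lie_zero] at this
  simp only [Module.End.mul_apply, ad_apply, LinearMap.zero_apply]
  rw [← lie_skew, map_neg, this, neg_zero]

lemma proj_mul_proj (hp : IsSubalgebraProj p) : p * p = p := by
  ext x; exact hp.idem x

lemma inner_eq_zero (hp : IsSubalgebraProj p) {v w : L} (hv : p v = v) (hw : p w = 0) :
    killingForm ℝ L v w = 0 := by
  have := hp.selfAdjoint v w
  rw [hv, hw, map_zero] at this
  simpa using this

variable {κ A s : ℝ}

local notation "tr" => LinearMap.trace ℝ L

lemma trace_ad_mul_ad (v w : L) : tr (ad ℝ L v * ad ℝ L w) = killingForm ℝ L v w := rfl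

lemma trace_proj_mul_eq_zero (hp : IsSubalgebraProj p) {v w : L} (hv : p v = v) (hw : p w = 0) :
    tr (p * (ad ℝ L v * ad ℝ L w)) = 0 := by
  have : tr (p * (ad ℝ L v * ad ℝ L w)) = tr (ad ℝ L v * (p * ad ℝ L w * p)) := by
    calc tr (p * (ad ℝ L v * ad ℝ L w)) = tr ((p * p) * (ad ℝ L v * ad ℝ L w)) := by
          rw [hp.proj_mul_proj]
      _ = tr (p * (p * ad ℝ L v * ad ℝ L w)) := by simp only [mul_assoc]
      _ = tr (p * (ad ℝ L v * (p * ad ℝ L w))) := by rw [hp.proj_mul_ad hv, mul_assoc]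
      _ = tr (ad ℝ L v * (p * ad ℝ L w) * p) := LinearMap.trace_mul_comm _ _ _
      _ = _ := by simp only [mul_assoc]
  rw [this, hp.proj_mul_ad_mul_proj hw, mul_zero, map_zero]

/-- For v in 𝔨 the operator is ½ ad v on 𝔨 and (½ + s) ad v on 𝔞. Since `ad v` commutes with p, the
two blocks contribute the shares κ and 1 - κ of the Killing form. -/
lemma trace_connectionOp_kk (hp : IsSubalgebraProj p)
    (hκ : ∀ v w, p v = v → p w = w →
      tr (p * (ad ℝ L v * ad ℝ L w)) = κ * killingForm ℝ L v w)
    {v w : L} (hv : p v = v) (hw : p w = w) :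
    tr (connectionOp p s v * connectionOp p s w) =
      (1 / 4) * (κ + (2 * s + 1) ^ 2 * (1 - κ)) * killingForm ℝ L v w := by
  have h : connectionOp p s v * connectionOp p s w =
      (1 / 2 + s) ^ 2 • (ad ℝ L v * ad ℝ L w)
        + (1 / 4 - (1 / 2 + s) ^ 2) • (p * (ad ℝ L v * ad ℝ L w)) := by
    have h1 : p * (ad ℝ L v * ad ℝ L w) = ad ℝ L v * ad ℝ L w * p := by
      rw [← mul_assoc, hp.proj_mul_ad hv, mul_assoc, hp.proj_mul_ad hw, mul_assoc]
    have h2 : ad ℝ L v * p * ad ℝ L w = ad ℝ L v * ad ℝ L w * p := by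
      rw [mul_assoc, hp.proj_mul_ad hw, mul_assoc]
    have h3 : ad ℝ L v * p * (ad ℝ L w * p) = ad ℝ L v * ad ℝ L w * p := by
      rw [← mul_assoc, h2, mul_assoc, hp.proj_mul_proj]
    simp only [connectionOp, hv, hw, add_mul, sub_mul, mul_add, mul_sub, smul_mul_assoc,
      mul_smul_comm, h1, h2, h3, ← mul_assoc (ad ℝ L v) (ad ℝ L w) p]
    module
  rw [h, map_add, map_smul, map_smul, hκ v w hv hw, trace_ad_mul_ad, smul_eq_mul, smul_eq_mul]
  ring

/-- For v in 𝔞 the operator is ½ ad v - s (ad v) p. The quadratic term in s vanishes by [𝔞, 𝔨] ⊆ 𝔞,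
and each of the two cross terms contributes -(s/2) A. -/
lemma trace_connectionOp_aa (hp : IsSubalgebraProj p)
    (hA : ∀ v w, p v = 0 → p w = 0 →
      tr (p * (ad ℝ L v * ad ℝ L w)) = A * killingForm ℝ L v w)
    {v w : L} (hv : p v = 0) (hw : p w = 0) :
    tr (connectionOp p s v * connectionOp p s w) =
      (1 / 4 - s * A) * killingForm ℝ L v w := by
  have h : connectionOp p s v * connectionOp p s w =
      (1 / 4 : ℝ) • (ad ℝ L v * ad ℝ L w) - (s / 2) • (ad ℝ L v * (p * ad ℝ L w))
        - (s / 2) • (ad ℝ L v * ad ℝ L w * p) := by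
    have h3 : ad ℝ L v * p * (ad ℝ L w * p) = 0 := by
      rw [mul_assoc, ← mul_assoc p, hp.proj_mul_ad_mul_proj hw, mul_zero]
    simp only [connectionOp, hv, hw, map_zero, smul_zero, add_zero, sub_mul, mul_sub,
      smul_mul_assoc, mul_smul_comm, h3]
    simp only [mul_assoc]
    module
  rw [h, map_sub, map_sub, map_smul, map_smul, map_smul,
    LinearMap.trace_mul_comm ℝ (ad ℝ L v * ad ℝ L w) p,
    LinearMap.trace_mul_comm ℝ (ad ℝ L v) (p * ad ℝ L w), mul_assoc, hA v w hv hw, hA w v hw hv,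
    LieModule.traceForm_comm ℝ L L w v, trace_ad_mul_ad, smul_eq_mul, smul_eq_mul]
  ring

lemma trace_connectionOp_ka (hp : IsSubalgebraProj p) {v w : L} (hv : p v = v) (hw : p w = 0) :
    tr (connectionOp p s v * connectionOp p s w) = 0 := by
  have h : connectionOp p s v * connectionOp p s w =
      ((1 / 2 + s) / 2) • (ad ℝ L v * ad ℝ L w) - (s * (1 / 2 + s)) • (ad ℝ L v * ad ℝ L w * p)
        - (s / 2) • (p * (ad ℝ L v * ad ℝ L w)) := by
    have h3 : ad ℝ L v * p * (ad ℝ L w * p) = 0 := by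
      rw [mul_assoc, ← mul_assoc p, hp.proj_mul_ad_mul_proj hw, mul_zero]
    have h4 : ad ℝ L v * p * ad ℝ L w = p * (ad ℝ L v * ad ℝ L w) := by
      rw [← hp.proj_mul_ad hv, mul_assoc]
    simp only [connectionOp, hv, hw, map_zero, smul_zero, add_zero, add_mul, sub_mul, mul_sub,
      smul_mul_assoc, mul_smul_comm, h3, h4, ← mul_assoc (ad ℝ L v) (ad ℝ L w) p]
    module
  rw [h, map_sub, map_sub, map_smul, map_smul, map_smul,
    LinearMap.trace_mul_comm ℝ (ad ℝ L v * ad ℝ L w) p, hp.trace_proj_mul_eq_zero hv hw,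
    trace_ad_mul_ad, hp.inner_eq_zero hv hw]
  simp

/-- The Ricci curvature of the metric `α Q|_𝔞 + α₁ Q|_𝔨` on the two summands. -/
lemma neg_trace_connectionOp (hp : IsSubalgebraProj p)
    (hκ : ∀ v w, p v = v → p w = w →
      tr (p * (ad ℝ L v * ad ℝ L w)) = κ * killingForm ℝ L v w)
    (hA : ∀ v w, p v = 0 → p w = 0 →
      tr (p * (ad ℝ L v * ad ℝ L w)) = A * killingForm ℝ L v w) (v w : L) :
    -tr (connectionOp p s v * connectionOp p s w) =
      (1 / 4) * (κ + (2 * s + 1) ^ 2 * (1 - κ)) * (-killingForm ℝ L) (p v) (p w)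
        + (1 / 4 - s * A) * (-killingForm ℝ L) (v - p v) (w - p w) := by
  have hk : ∀ x, p (p x) = p x := hp.idem
  have ha : ∀ x, p (x - p x) = 0 := fun x => by rw [map_sub, hk, sub_self]
  have hsplit : ∀ x, connectionOp p s x = connectionOp p s (p x) + connectionOp p s (x - p x) :=
    fun x => by rw [← connectionOp_add, add_sub_cancel]
  rw [hsplit v, hsplit w, add_mul, mul_add, mul_add, map_add, map_add, map_add,
    hp.trace_connectionOp_kk hκ (hk v) (hk w), hp.trace_connectionOp_ka (hk v) (ha w),
    LinearMap.trace_mul_comm ℝ (connectionOp p s (v - p v)),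
    hp.trace_connectionOp_ka (hk w) (ha v), hp.trace_connectionOp_aa hA (ha v) (ha w)]
  simp only [LinearMap.neg_apply]
  ring

end IsSubalgebraProj

end ReductivePair

/-! ### The constants κ and A, the curvature and the Koszul identity. -/

section SimpleSubalgebra

open LieAlgebra

variable {L H : Type*} [LieRing L] [LieAlgebra ℝ L] [LieRing H] [LieAlgebra ℝ H]

/-- The restriction of minus the Killing form along a homomorphism of Lie algebras. -/
noncomputable abbrev pullForm (φ : H →ₗ⁅ℝ⁆ L) : LinearMap.BilinForm ℝ H :=
  (-killingForm ℝ L).compl₁₂ (φ : H →ₗ[ℝ] L) (φ : H →ₗ[ℝ] L)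

lemma pullForm_lie (φ : H →ₗ⁅ℝ⁆ L) (z x y : H) :
    pullForm φ ⁅z, x⁆ y = -pullForm φ x ⁅z, y⁆ := by
  simpa using neg_killingForm_lie (φ z) (φ x) (φ y)

variable {φ : H →ₗ⁅ℝ⁆ L} {ι : Type*} [Fintype ι] {e : ι → H}

lemma frameProj_mem_range (x : L) :
    frameProj (-killingForm ℝ L) (fun i => φ (e i)) x ∈ LinearMap.range (φ : H →ₗ[ℝ] L) := by
  rw [frameProj_apply]
  exact Submodule.sum_mem _ fun i _ => Submodule.smul_mem _ _ ⟨e i, rfl⟩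

lemma frameProj_map (he : ∀ x, x = ∑ i, pullForm φ (e i) x • e i) (x : H) :
    frameProj (-killingForm ℝ L) (fun i => φ (e i)) (φ x) = φ x := by
  conv_rhs => rw [he x]
  rw [frameProj_apply, map_sum]
  simp

lemma frameProj_eq_self_iff (he : ∀ x, x = ∑ i, pullForm φ (e i) x • e i) (x : L) :
    frameProj (-killingForm ℝ L) (fun i => φ (e i)) x = x ↔
      x ∈ LinearMap.range (φ : H →ₗ[ℝ] L) := by
  constructor
  · intro h
    rw [← h]
    exact frameProj_mem_range x
  · rintro ⟨y, rfl⟩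
    exact frameProj_map he y

lemma frameProj_selfAdjoint (hq : IsInner (-killingForm ℝ L)) (e : ι → L) (x y : L) :
    (-killingForm ℝ L) (frameProj (-killingForm ℝ L) e x) y =
      (-killingForm ℝ L) x (frameProj (-killingForm ℝ L) e y) := by
  rw [frameProj_apply, frameProj_apply, map_sum, map_sum, LinearMap.sum_apply]
  refine Finset.sum_congr rfl fun i _ => ?_
  rw [map_smul, map_smul, LinearMap.smul_apply, smul_eq_mul, smul_eq_mul, hq.symm x, mul_comm]

lemma frameProj_eq_zero_iff (hq : IsInner (-killingForm ℝ L))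
    (he : ∀ x, x = ∑ i, pullForm φ (e i) x • e i) (x : L) :
    frameProj (-killingForm ℝ L) (fun i => φ (e i)) x = 0 ↔
      x ∈ (-killingForm ℝ L).orthogonal (LinearMap.range (φ : H →ₗ[ℝ] L)) := by
  rw [LinearMap.BilinForm.mem_orthogonal_iff]
  constructor
  · rintro h _ ⟨y, rfl⟩
    change (-killingForm ℝ L) (φ y) x = 0
    rw [← frameProj_map he y, frameProj_selfAdjoint hq, h, map_zero]
  · intro h
    rw [frameProj_apply]
    refine Finset.sum_eq_zero fun i _ => ?_
    rw [show (-killingForm ℝ L) (φ (e i)) x = 0 from h _ ⟨e i, rfl⟩, zero_smul]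

lemma isSubalgebraProj_frameProj (hq : IsInner (-killingForm ℝ L))
    (he : ∀ x, x = ∑ i, pullForm φ (e i) x • e i) :
    IsSubalgebraProj (frameProj (-killingForm ℝ L) (fun i => φ (e i))) where
  inner := hq
  idem x := (frameProj_eq_self_iff he _).mpr (frameProj_mem_range x)
  selfAdjoint := frameProj_selfAdjoint hq _
  lie_mem x y := by
    obtain ⟨a, ha⟩ := frameProj_mem_range (φ := φ) (e := e) x
    obtain ⟨b, hb⟩ := frameProj_mem_range (φ := φ) (e := e) y
    rw [frameProj_eq_self_iff he, ← ha, ← hb]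
    exact ⟨⁅a, b⁆, φ.map_lie a b⟩

/-- The trace weighted by p only sees 𝔨, where `ad (φ X)` acts as `ad X`. This is how κ enters the
Ricci form. -/
lemma trace_frameProj_mul_ad_map [Module.Finite ℝ L] [Module.Finite ℝ H]
    (he : ∀ x, x = ∑ i, pullForm φ (e i) x • e i) (X Y : H) :
    LinearMap.trace ℝ L (frameProj (-killingForm ℝ L) (fun i => φ (e i)) *
      (ad ℝ L (φ X) * ad ℝ L (φ Y))) = killingForm ℝ H X Y := by
  rw [trace_frameProj_mul, LieModule.traceForm_apply_apply, trace_eq_sum_frame he]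
  simp

/-- The centraliser condition of the complement forces a simple subalgebra to be an ideal. -/
lemma eq_zero_or_eq_top_of_commute [IsSimple ℝ L] {p : Module.End ℝ L} (hp : IsSubalgebraProj p)
    (h : ∀ v w, p v = v → p w = 0 → ⁅v, w⁆ = 0) : (∀ x, p x = 0) ∨ ∀ x, p x = x := by
  -- Only brackets with 𝔨 could move 𝔨, since 𝔞 commutes with it; so 𝔨, the fixed space of p, is an
  -- ideal of 𝔤.
  let I : LieIdeal ℝ L :=
    { LinearMap.ker (p - 1) with
      lie_mem := fun {x y} hy => by
        replace hy : p y = y := by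
          simpa [sub_eq_zero] using hy
        have hx : ⁅x, y⁆ = ⁅p x, y⁆ := by
          have := h y (x - p x) hy (by rw [map_sub, hp.idem, sub_self])
          rw [lie_sub, sub_eq_zero] at this
          rw [← lie_skew, this, lie_skew]
        have : p ⁅x, y⁆ = ⁅x, y⁆ := by rw [hx, hp.lie_proj, hy]
        simpa [sub_eq_zero] using this }
  have hI : ∀ x, x ∈ I ↔ p x = x := fun x => by
    change (p - 1) x = 0 ↔ _
    simp [sub_eq_zero]
  rcases IsSimple.eq_bot_or_eq_top (R := ℝ) I with h' | h'
  · left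
    intro x
    have : p x ∈ I := (hI _).mpr (hp.idem x)
    simpa [h'] using this
  · right
    intro x
    exact (hI x).mp (by simp [h'])

/-- A sum of squares with a sign: it bounds κ by 1, and it is one side of the double counting that
determines A. -/
lemma trace_compl_mul_ad [Module.Finite ℝ L] {p : Module.End ℝ L} (hp : IsSubalgebraProj p)
    {ι' : Type*} [Fintype ι'] {E : ι' → L}
    (hE : ∀ x, x = ∑ i, (-killingForm ℝ L) (E i) x • E i) {v : L} (hv : p v = v) :
    LinearMap.trace ℝ L ((1 - p) * (ad ℝ L v * ad ℝ L v)) =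
      -∑ i, (-killingForm ℝ L) ⁅v, E i - p (E i)⁆ ⁅v, E i - p (E i)⁆ := by
  have hc : ∀ y, p ⁅v, y⁆ = ⁅v, p y⁆ := fun y => by
    have := hp.lie_proj v y
    rwa [hv] at this
  rw [trace_eq_sum_frame hE, ← Finset.sum_neg_distrib]
  refine Finset.sum_congr rfl fun i _ => ?_
  rw [neg_killingForm_lie, neg_neg]
  have h : ((1 - p) * (ad ℝ L v * ad ℝ L v)) (E i) = ⁅v, ⁅v, E i - p (E i)⁆⁆ := by
    simp [hc, lie_sub]
  have h0 : (-killingForm ℝ L) (p (E i)) ⁅v, ⁅v, E i - p (E i)⁆⁆ = 0 := by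
    rw [hp.selfAdjoint, hc, hc, map_sub, hp.idem, sub_self, lie_zero, lie_zero, map_zero]
  rw [h, map_sub (-killingForm ℝ L), LinearMap.sub_apply, h0, sub_zero]

lemma trace_ad_eq_zero [Module.Finite ℝ L] (hq : IsInner (-killingForm ℝ L)) (z : L) :
    LinearMap.trace ℝ L (ad ℝ L z) = 0 := by
  obtain ⟨E, hE⟩ := hq.exists_frame
  rw [trace_eq_sum_frame hE]
  refine Finset.sum_eq_zero fun i _ => ?_
  have h := neg_killingForm_lie z (E i) (E i)
  rw [hq.symm] at h
  rw [ad_apply]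
  linarith

/-- The compression of the skew operator `ad z` to 𝔨 is skew, so traceless. This yields the symmetry
of tr(p ad v ad w) and the tracelessness of the connection operators. -/
lemma IsSubalgebraProj.trace_proj_mul_ad [Module.Finite ℝ L] {p : Module.End ℝ L}
    (hp : IsSubalgebraProj p) (z : L) : LinearMap.trace ℝ L (p * ad ℝ L z) = 0 := by
  obtain ⟨E, hE⟩ := hp.inner.exists_frame
  rw [← hp.proj_mul_proj, mul_assoc, LinearMap.trace_mul_comm, trace_eq_sum_frame hE]
  refine Finset.sum_eq_zero fun i _ => ?_
  have h1 : (p * ad ℝ L z * p) (E i) = p ⁅z, p (E i)⁆ := rfl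
  have h2 := neg_killingForm_lie z (p (E i)) (p (E i))
  rw [hp.inner.symm] at h2
  rw [h1, ← hp.selfAdjoint]
  linarith

/-- The Killing form of a simple subalgebra is a positive multiple of the Killing form. -/
lemma exists_killingForm_eq_mul [Module.Finite ℝ L] [Module.Finite ℝ H] [IsSimple ℝ H]
    (hq : IsInner (-killingForm ℝ L)) (hφ : Function.Injective φ) :
    ∃ κ : ℝ, 0 < κ ∧ ∀ X Y, killingForm ℝ H X Y = κ * killingForm ℝ L (φ X) (φ Y) := by
  have hB : IsInner (pullForm φ) := hq.comp _ hφ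
  have hH : IsInner (-killingForm ℝ H) :=
    isInner_neg_killingForm hB (pullForm_lie φ) center_trivial_of_isSimple
  obtain ⟨r, hr⟩ := exists_eq_smul_of_isSimple hB hH.symm (pullForm_lie φ) neg_killingForm_lie
  have hnt : ∃ X : H, X ≠ 0 := by
    by_contra! h
    exact IsSimple.non_abelian ℝ (L := H) ⟨fun x y => h _⟩
  obtain ⟨X, hX⟩ := hnt
  refine ⟨r, ?_, fun X Y => ?_⟩
  · have h1 := hH.pos X hX
    rw [hr] at h1
    exact pos_of_mul_pos_left h1 (hB.pos X hX).le
  · have := hr X Y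
    simp only [LinearMap.neg_apply, LinearMap.compl₁₂_apply] at this
    simp only [LieHom.coe_toLinearMap] at this
    linarith

/-- For v in 𝔨, (1 - κ) Q(v, v) is the sum of the squared lengths of the brackets of v with the
𝔞-parts of a frame. If κ ≥ 1, these vanish and 𝔨 commutes with 𝔞. Then 𝔨 is an ideal of 𝔤, so it is
0, against its simplicity, or 𝔤, against a ≠ 0. -/
lemma killingForm_ratio_lt_one [Module.Finite ℝ L] [Module.Finite ℝ H] [IsSimple ℝ L]
    [IsSimple ℝ H] (hq : IsInner (-killingForm ℝ L)) (hφ : Function.Injective φ)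
    (he : ∀ x, x = ∑ i, pullForm φ (e i) x • e i)
    {κ : ℝ} (hκ : ∀ X Y, killingForm ℝ H X Y = κ * killingForm ℝ L (φ X) (φ Y))
    {a : L} (ha : a ≠ 0) (hpa : frameProj (-killingForm ℝ L) (fun i => φ (e i)) a = 0) :
    κ < 1 := by
  by_contra hle
  have hp := isSubalgebraProj_frameProj hq he
  set p := frameProj (-killingForm ℝ L) (fun i => φ (e i)) with hpdef
  obtain ⟨E, hE⟩ := hq.exists_frame
  have key : ∀ v w, p v = v → p w = 0 → ⁅v, w⁆ = 0 := by
    intro v w hv hw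
    obtain ⟨X, rfl⟩ := (frameProj_eq_self_iff he v).mp hv
    have h1 := trace_compl_mul_ad hp hE hv
    have h2 := trace_frameProj_mul_ad_map he X X
    rw [sub_mul, one_mul, map_sub] at h1
    change _ - LinearMap.trace ℝ L (p * (ad ℝ L (φ X) * ad ℝ L (φ X))) = _ at h1
    rw [h2, hκ, IsSubalgebraProj.trace_ad_mul_ad] at h1
    have h3 : 0 ≤ (-killingForm ℝ L) (φ X) (φ X) := hq.nonneg _
    have h4 : ∑ i, (-killingForm ℝ L) ⁅φ X, E i - p (E i)⁆ ⁅φ X, E i - p (E i)⁆ = 0 := by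
      refine le_antisymm ?_ (Finset.sum_nonneg fun i _ => hq.nonneg _)
      simp only [LieHom.coe_toLinearMap, LinearMap.neg_apply] at h1 h3 ⊢
      nlinarith
    rw [Finset.sum_eq_zero_iff_of_nonneg fun i _ => hq.nonneg _] at h4
    have h5 : w = ∑ i, (-killingForm ℝ L) (E i) w • (E i - p (E i)) := by
      have : w - p w = ∑ i, (-killingForm ℝ L) (E i) w • (E i - p (E i)) := by
        conv_lhs => rw [hE w]
        rw [map_sum, ← Finset.sum_sub_distrib]
        simp only [map_smul, smul_sub]
      rwa [hw, sub_zero] at this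
    rw [h5, lie_sum]
    refine Finset.sum_eq_zero fun i hi => ?_
    rw [lie_smul]
    change _ • ⁅φ X, E i - p (E i)⁆ = 0
    rw [hq.eq_zero (h4 i hi).le, smul_zero]
  rcases eq_zero_or_eq_top_of_commute hp key with h | h
  · refine IsSimple.non_abelian ℝ (L := H) ⟨fun x y => hφ ?_⟩
    rw [map_zero, ← frameProj_map he, h]
  · exact ha ((h a).symm.trans hpa)

/-- If the trace form `tr(p ad v ad w)` on the complement is a multiple `A` of the Killing form,
then `A` is determined by taking the trace. -/
lemma casimir_mul_finrank [Module.Finite ℝ L] [Module.Finite ℝ H]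
    (hq : IsInner (-killingForm ℝ L)) (he : ∀ x, x = ∑ i, pullForm φ (e i) x • e i)
    {κ A : ℝ} (hκ : ∀ X Y, killingForm ℝ H X Y = κ * killingForm ℝ L (φ X) (φ Y))
    {p : Module.End ℝ L} (hpdef : p = frameProj (-killingForm ℝ L) (fun i => φ (e i)))
    (hA : ∀ v w, p v = 0 → p w = 0 →
      LinearMap.trace ℝ L (p * (ad ℝ L v * ad ℝ L w)) = A * killingForm ℝ L v w) :
    A * Module.finrank ℝ (LinearMap.ker p) =
      (1 - κ) * Module.finrank ℝ (LinearMap.range (φ : H →ₗ[ℝ] L)) := by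
  have hp : IsSubalgebraProj p := hpdef ▸ isSubalgebraProj_frameProj hq he
  obtain ⟨E, hE⟩ := hq.exists_frame
  have ha : ∀ x, p (x - p x) = 0 := fun x => by rw [map_sub, hp.idem, sub_self]
  have hk : ∀ j, p (φ (e j)) = φ (e j) := fun j => by rw [hpdef, frameProj_map he]
  have htrp : LinearMap.trace ℝ L p = Module.finrank ℝ (LinearMap.range (φ : H →ₗ[ℝ] L)) := by
    refine LinearMap.IsProj.trace ⟨fun x => ?_, fun x hx => ?_⟩
    · rw [hpdef]; exact frameProj_mem_range x
    · rw [hpdef]; exact (frameProj_eq_self_iff he x).mpr hx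
  have htrP : LinearMap.trace ℝ L (1 - p) = Module.finrank ℝ (LinearMap.ker p) := by
    refine LinearMap.IsProj.trace ⟨fun x => ?_, fun x hx => ?_⟩
    · exact ha x
    · rw [LinearMap.mem_ker] at hx
      simp [hx]
  have h1 : ∑ j, LinearMap.trace ℝ L ((1 - p) * (ad ℝ L (φ (e j)) * ad ℝ L (φ (e j)))) =
      -((1 - κ) * Module.finrank ℝ (LinearMap.range (φ : H →ₗ[ℝ] L))) := by
    have : LinearMap.trace ℝ L p = ∑ j, (-killingForm ℝ L) (φ (e j)) (φ (e j)) := by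
      have := trace_frameProj_mul (-killingForm ℝ L) (fun i => φ (e i)) 1
      rw [mul_one, ← hpdef] at this
      exact this
    rw [← htrp, this, Finset.mul_sum, ← Finset.sum_neg_distrib]
    refine Finset.sum_congr rfl fun j _ => ?_
    rw [sub_mul, one_mul, map_sub, hpdef, trace_frameProj_mul_ad_map he, hκ,
      IsSubalgebraProj.trace_ad_mul_ad]
    simp only [LinearMap.neg_apply]
    ring
  have h2 : ∑ i, LinearMap.trace ℝ L (p * (ad ℝ L (E i - p (E i)) * ad ℝ L (E i - p (E i)))) =
      -(A * Module.finrank ℝ (LinearMap.ker p)) := by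
    rw [← htrP, trace_eq_sum_frame hE, Finset.mul_sum, ← Finset.sum_neg_distrib]
    refine Finset.sum_congr rfl fun i _ => ?_
    rw [hA _ _ (ha _) (ha _)]
    have h3 : (-killingForm ℝ L) (p (E i)) (E i - p (E i)) = 0 := by
      rw [hp.selfAdjoint, ha, map_zero]
    have h4 : ((1 - p : Module.End ℝ L)) (E i) = E i - p (E i) := rfl
    rw [h4]
    have h5 : (-killingForm ℝ L) (E i) (E i - p (E i)) =
        (-killingForm ℝ L) (E i - p (E i)) (E i - p (E i)) := by
      rw [map_sub (-killingForm ℝ L) (E i) (p (E i)), LinearMap.sub_apply, h3, sub_zero]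
    rw [h5, LinearMap.neg_apply, LinearMap.neg_apply, mul_neg, neg_neg]
  -- Both sides equal minus the double sum over i, j of the squared lengths of the brackets of `φ (e
  -- j)` with the 𝔞-part of `E i`.
  have h3 : ∑ j, LinearMap.trace ℝ L ((1 - p) * (ad ℝ L (φ (e j)) * ad ℝ L (φ (e j)))) =
      ∑ i, LinearMap.trace ℝ L (p * (ad ℝ L (E i - p (E i)) * ad ℝ L (E i - p (E i)))) := by
    simp_rw [trace_compl_mul_ad hp hE (hk _)]
    have h4 : ∀ w, LinearMap.trace ℝ L (p * (ad ℝ L w * ad ℝ L w)) =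
        -∑ j, (-killingForm ℝ L) ⁅φ (e j), w⁆ ⁅φ (e j), w⁆ := by
      intro w
      rw [hpdef, trace_frameProj_mul, ← Finset.sum_neg_distrib]
      refine Finset.sum_congr rfl fun j _ => ?_
      have h5 : ⁅φ (e j), w⁆ = -⁅w, φ (e j)⁆ := (lie_skew _ _).symm
      have h6 := neg_killingForm_lie w (φ (e j)) ⁅w, φ (e j)⁆
      have h7 : ∀ u : L, (-killingForm ℝ L) (-u) (-u) = (-killingForm ℝ L) u u := fun u => by simp
      rw [h5, h7, h6, neg_neg]
      rfl
    simp_rw [h4]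
    rw [Finset.sum_neg_distrib, Finset.sum_neg_distrib, Finset.sum_comm]
  linarith

/-- Schur's lemma for the trace form `tr(p ad v ad w)` on the complement of a subalgebra, which is
irreducible under a set of automorphisms preserving the subalgebra. -/
lemma exists_casimir [Module.Finite ℝ L] {p : Module.End ℝ L} (hp : IsSubalgebraProj p)
    (S : Set (L ≃ₗ⁅ℝ⁆ L)) (hS : ∀ θ ∈ S, ∀ x, p (θ x) = θ (p x))
    (hne : LinearMap.ker p ≠ ⊥)
    (hirr : ∀ W : Submodule ℝ L, W ≤ LinearMap.ker p → (∀ θ ∈ S, ∀ x ∈ W, θ x ∈ W) →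
      W = ⊥ ∨ W = LinearMap.ker p) :
    ∃ A : ℝ, ∀ v w, p v = 0 → p w = 0 →
      LinearMap.trace ℝ L (p * (ad ℝ L v * ad ℝ L w)) = A * killingForm ℝ L v w := by
  let τ : LinearMap.BilinForm ℝ L := LinearMap.mk₂ ℝ
    (fun v w => LinearMap.trace ℝ L (p * (ad ℝ L v * ad ℝ L w)))
    (fun v v' w => by simp [add_mul, mul_add]) (fun c v w => by simp)
    (fun v w w' => by simp [mul_add]) (fun c v w => by simp)
  have hτs : ∀ v w, τ v w = τ w v := by
    intro v w
    have h : τ v w - τ w v = LinearMap.trace ℝ L (p * ad ℝ L ⁅v, w⁆) := by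
      have h' : ad ℝ L ⁅v, w⁆ = ad ℝ L v * ad ℝ L w - ad ℝ L w * ad ℝ L v := by
        ext x; simp
      rw [h', mul_sub, map_sub]
      rfl
    rw [hp.trace_proj_mul_ad] at h
    exact sub_eq_zero.mp h
  have hτθ : ∀ θ ∈ S, ∀ v w, τ (θ v) (θ w) = τ v w := by
    intro θ hθ v w
    have h : p * (ad ℝ L (θ v) * ad ℝ L (θ w)) =
        (θ : L →ₗ[ℝ] L) * ((p * (ad ℝ L v * ad ℝ L w)) * (θ.symm : L →ₗ[ℝ] L)) := by
      ext x
      obtain ⟨y, rfl⟩ := θ.surjective x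
      simp [← LieEquiv.map_lie, hS θ hθ]
    have h' : (θ.symm : L →ₗ[ℝ] L) * (θ : L →ₗ[ℝ] L) = 1 := by
      ext x; simp
    change LinearMap.trace ℝ L (p * (ad ℝ L (θ v) * ad ℝ L (θ w))) = _
    rw [h, LinearMap.trace_mul_comm, mul_assoc, h', mul_one]
    rfl
  have hB : IsInner ((-killingForm ℝ L).compl₁₂ (LinearMap.ker p).subtype
      (LinearMap.ker p).subtype) := hp.inner.comp _ (Submodule.subtype_injective _)
  have hnt : Nontrivial (LinearMap.ker p) := Submodule.nontrivial_iff_ne_bot.mpr hne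
  obtain ⟨r, ⟨v, hv⟩, hv0, h⟩ := hB.exists_eigenvector
    (τ.compl₁₂ (LinearMap.ker p).subtype (LinearMap.ker p).subtype) (fun x y => hτs _ _)
  -- The r-eigenspace of τ inside 𝔞 is invariant under S, because τ and the Killing form are, and it
  -- contains v ≠ 0.
  let W : Submodule ℝ L :=
    { carrier := {v | p v = 0 ∧ ∀ w, p w = 0 → τ v w = r * (-killingForm ℝ L) v w}
      add_mem' := fun {a b} ha hb => ⟨by rw [map_add, ha.1, hb.1, add_zero], fun w hw => by
        rw [map_add, map_add, LinearMap.add_apply, LinearMap.add_apply, ha.2 w hw, hb.2 w hw,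
          mul_add]⟩
      zero_mem' := ⟨map_zero p, fun w _ => by simp⟩
      smul_mem' := fun c a ha => ⟨by rw [map_smul, ha.1, smul_zero], fun w hw => by
        rw [map_smul, map_smul, LinearMap.smul_apply, LinearMap.smul_apply, ha.2 w hw,
          smul_eq_mul, smul_eq_mul, mul_left_comm]⟩ }
  have hW : W = LinearMap.ker p := by
    refine (hirr W (fun x hx => hx.1) ?_).resolve_left ?_
    · rintro θ hθ x ⟨hx, hx'⟩
      refine ⟨by rw [hS θ hθ, hx, map_zero], fun w hw => ?_⟩
      obtain ⟨u, rfl⟩ : ∃ u, θ u = w := θ.surjective w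
      have hu : p u = 0 := θ.injective (show θ (p u) = θ 0 by rw [← hS θ hθ, hw, map_zero])
      rw [hτθ θ hθ, hx' u hu, LinearMap.neg_apply, LinearMap.neg_apply, LinearMap.neg_apply,
        LinearMap.neg_apply, LieAlgebra.killingForm_of_equiv_apply]
    · intro hbot
      have : v ∈ W := ⟨hv, fun w hw => h ⟨w, hw⟩⟩
      rw [hbot, Submodule.mem_bot] at this
      exact hv0 (Subtype.ext this)
  -- The sign appears because r is relative to minus the Killing form.
  refine ⟨-r, fun v w hv hw => ?_⟩
  have hvW : v ∈ W := hW ▸ (show v ∈ LinearMap.ker p from hv)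
  have := hvW.2 w hw
  simp only [LinearMap.neg_apply] at this
  rw [neg_mul, ← mul_neg]
  exact this

/-- The curvature `R(u, v) w` of the connection `∇_X Y`. -/
noncomputable def connectionCurvature (p : Module.End ℝ L) (s : ℝ) (u v w : L) : L :=
  connection p s u (connection p s v w) - connection p s v (connection p s u w)
    - connection p s ⁅u, v⁆ w

/-- The Ricci curvature of the connection in terms of traces of `u ↦ ∇_u v`. -/
lemma sum_coord_connectionCurvature [Module.Finite ℝ L] {p : Module.End ℝ L}
    (hp : IsSubalgebraProj p) (s : ℝ) {ι' : Type*} [Fintype ι'] (b : Module.Basis ι' ℝ L)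
    (v w : L) :
    ∑ i, b.coord i (connectionCurvature p s (b i) v w) =
      -LinearMap.trace ℝ L (connectionOp p s v * connectionOp p s w) := by
  classical
  -- u ↦ R(u, v)w as an operator. Its trace loses the first term, by tracelessness, and the
  -- commutator of `ad v` with `connectionOp p s w`.
  let R : Module.End ℝ L := -connectionOp p s (connection p s v w)
    + (ad ℝ L v - connectionOp p s v) * connectionOp p s w - connectionOp p s w * ad ℝ L v
  have hR : ∀ u, connectionCurvature p s u v w = R u := by
    intro u
    have h : ∀ Y, connection p s v Y = ⁅v, Y⁆ - connectionOp p s v Y := fun Y => by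
      rw [← connection_sub_comm p s v Y, connection_eq_neg_connectionOp p s Y v]
      abel
    simp only [connectionCurvature, R, connection_eq_neg_connectionOp p s u,
      connection_eq_neg_connectionOp p s ⁅u, v⁆, LinearMap.sub_apply, LinearMap.add_apply,
      LinearMap.neg_apply, Module.End.mul_apply, ad_apply]
    rw [h (-connectionOp p s w u), ← lie_skew u v, map_neg, map_neg, lie_neg]
    abel
  have h0 : ∀ Y, LinearMap.trace ℝ L (connectionOp p s Y) = 0 := fun Y => by
    rw [connectionOp, map_sub, map_add, map_smul, map_smul, map_smul, LinearMap.trace_mul_comm,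
      hp.trace_proj_mul_ad, trace_ad_eq_zero hp.inner, trace_ad_eq_zero hp.inner]
    simp
  have htr : LinearMap.trace ℝ L R =
      -LinearMap.trace ℝ L (connectionOp p s v * connectionOp p s w) := by
    simp only [R]
    rw [sub_mul, map_sub, map_add, map_neg, map_sub, h0,
      LinearMap.trace_mul_comm ℝ (connectionOp p s w)]
    ring
  rw [← htr, LinearMap.trace_eq_matrix_trace ℝ b, Matrix.trace]
  refine Finset.sum_congr rfl fun i _ => ?_
  rw [hR, Matrix.diag_apply, LinearMap.toMatrix_apply, Module.Basis.coord_apply]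

/-- The Koszul identity for the connection and the metric `α Q|_𝔞 + α₁ Q|_𝔨`. -/
lemma connection_koszul {p : Module.End ℝ L} (hp : IsSubalgebraProj p)
    {g : LinearMap.BilinForm ℝ L} {α α₁ s : ℝ} (hs : α * (2 * s + 1) = α₁)
    (hg : ∀ v w, g v w = α * (-killingForm ℝ L) (v - p v) (w - p w)
      + α₁ * (-killingForm ℝ L) (p v) (p w)) (X Y Z : L) :
    2 * g (connection p s X Y) Z = g ⁅X, Y⁆ Z - g ⁅X, Z⁆ Y - g ⁅Y, Z⁆ X := by
  have hq := hp.inner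
  -- With S = α + (α₁ - α)p one has g(v, w) = Q(Sv, w). The Koszul identity becomes the vector
  -- identity 2 S∇_X Y = S[X, Y] + [X, SY] + [Y, SX], proved in `key`.
  have hg' : ∀ v w, g v w = (-killingForm ℝ L) (α • v + (α₁ - α) • p v) w := by
    intro v w
    have h1 : (-killingForm ℝ L) (v - p v) (p w) = 0 := by
      rw [← hp.selfAdjoint, map_sub, hp.idem, sub_self, map_zero, LinearMap.zero_apply]
    have h2 : (-killingForm ℝ L) (p v) (p w) = (-killingForm ℝ L) (p v) w := by
      rw [← hp.selfAdjoint, hp.idem]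
    rw [hg, map_sub ((-killingForm ℝ L) (v - p v)), h1, h2]
    simp only [map_add, map_smul, map_sub, LinearMap.add_apply, LinearMap.sub_apply,
      LinearMap.smul_apply, smul_eq_mul]
    ring
  have hadj : ∀ V W : L, g ⁅V, Z⁆ W = -(-killingForm ℝ L) ⁅V, α • W + (α₁ - α) • p W⁆ Z := by
    intro V W
    have hsymm : g ⁅V, Z⁆ W = g W ⁅V, Z⁆ := by
      rw [hg, hg, hq.symm, hq.symm (p _)]
    rw [hsymm, hg', neg_killingForm_lie, neg_neg]
  have hU : p (connection p s X Y) = (1 / 2 : ℝ) • p ⁅X, Y⁆ := by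
    have h1 : p ⁅X, p Y⁆ = ⁅p X, p Y⁆ := by
      rw [← lie_skew, map_neg, hp.lie_proj, lie_skew]
    simp only [connection, map_add, map_smul, map_sub, sub_lie, lie_sub, h1, hp.lie_proj, hp.idem]
    module
  have key : (2 : ℝ) • (α • connection p s X Y + (α₁ - α) • p (connection p s X Y)) =
      (α • ⁅X, Y⁆ + (α₁ - α) • p ⁅X, Y⁆) + ⁅X, α • Y + (α₁ - α) • p Y⁆
        + ⁅Y, α • X + (α₁ - α) • p X⁆ := by
    rw [hU]
    simp only [connection, sub_lie, lie_sub, lie_add, lie_smul, ← lie_skew X Y, ← lie_skew (p X) Y,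
      ← hs]
    module
  rw [hg', hg', hadj, hadj, sub_neg_eq_add, sub_neg_eq_add, ← LinearMap.add_apply,
    ← LinearMap.add_apply, ← map_add, ← map_add, ← key, map_smul, LinearMap.smul_apply,
    smul_eq_mul]

end SimpleSubalgebra

/-! ### Calculus in the chart at the identity. -/

section UnitChart

open Filter
open scoped Topology

variable {m : ℕ} {G : Type*} [TopologicalSpace G] [ChartedSpace (EuclideanSpace ℝ (Fin m)) G]

/-- The model space of an `m`-dimensional manifold. -/
local notation "𝔼" m => EuclideanSpace ℝ (Fin m)

/-- The derivative of a map of manifolds, as a map between the model spaces. -/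
noncomputable def flatDeriv (m l : ℕ) {M N : Type*} [TopologicalSpace M]
    [ChartedSpace (𝔼 m) M] [TopologicalSpace N] [ChartedSpace (𝔼 l) N]
    (f : M → N) (x : M) : (𝔼 m) →L[ℝ] 𝔼 l :=
  mfderiv (𝓡 m) (𝓡 l) f x

section Flat

variable {k l : ℕ} {M N P : Type*} [TopologicalSpace M]
    [ChartedSpace (𝔼 m) M] [TopologicalSpace N] [ChartedSpace (𝔼 l) N] [TopologicalSpace P]
    [ChartedSpace (𝔼 k) P]

lemma flatDeriv_comp {f : M → N} {g : N → P} {x : M}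
    (hg : MDifferentiableAt (𝓡 l) (𝓡 k) g (f x)) (hf : MDifferentiableAt (𝓡 m) (𝓡 l) f x) :
    flatDeriv m k (fun y => g (f y)) x = (flatDeriv l k g (f x)).comp (flatDeriv m l f x) :=
  mfderiv_comp x hg hf

lemma flatDeriv_id (x : M) : flatDeriv m m (fun y => y) x = ContinuousLinearMap.id ℝ (𝔼 m) :=
  mfderiv_id

lemma flatDeriv_eq_fderiv (f : (𝔼 m) → 𝔼 l) (x : 𝔼 m) : flatDeriv m l f x = fderiv ℝ f x :=
  mfderiv_eq_fderiv

end Flat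

lemma flatDeriv_extChartAt_self [IsManifold (𝓡 m) 1 G] (x : G) :
    flatDeriv m m (extChartAt (𝓡 m) x) x = ContinuousLinearMap.id ℝ (𝔼 m) :=
  mfderiv_extChartAt_self

lemma flatDeriv_extChartAt_symm_self [IsManifold (𝓡 m) 1 G] (x : G) :
    flatDeriv m m (extChartAt (𝓡 m) x).symm (extChartAt (𝓡 m) x x) =
      ContinuousLinearMap.id ℝ (𝔼 m) := by
  have := mfderivWithin_range_extChartAt_symm (I := 𝓡 m) (x := x)
  rwa [ModelWithCorners.range_eq_univ, mfderivWithin_univ] at this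

lemma mdifferentiableAt_extChartAt_symm [IsManifold (𝓡 m) 1 G] {x : G} {ξ : 𝔼 m}
    (h : ξ ∈ (extChartAt (𝓡 m) x).target) :
    MDifferentiableAt (𝓡 m) (𝓡 m) (extChartAt (𝓡 m) x).symm ξ := by
  have := mdifferentiableWithinAt_extChartAt_symm h
  rwa [ModelWithCorners.range_eq_univ, mdifferentiableWithinAt_univ] at this

lemma mpullbackWithin_extChartAt_symm [IsManifold (𝓡 m) 1 G] {x : G}
    (V : ∀ y : G, TangentSpace (𝓡 m) y) {ξ : 𝔼 m} (h : ξ ∈ (extChartAt (𝓡 m) x).target) :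
    mpullbackWithin (𝓡 m) (𝓡 m) (extChartAt (𝓡 m) x).symm V (Set.range (𝓡 m)) ξ =
    flatDeriv m m (extChartAt (𝓡 m) x) ((extChartAt (𝓡 m) x).symm ξ)
      (V ((extChartAt (𝓡 m) x).symm ξ)) := by
  rw [mpullbackWithin_apply]
  exact DFunLike.congr_fun (ContinuousLinearMap.inverse_eq
    (mfderivWithin_extChartAt_symm_comp_mfderiv_extChartAt h)
    (mfderiv_extChartAt_comp_mfderivWithin_extChartAt_symm h)) _

variable [Group G]

/-- The multiplication of a Lie group read in the chart at the identity. -/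
noncomputable def chartMul (m : ℕ) (G : Type*) [TopologicalSpace G]
    [ChartedSpace (EuclideanSpace ℝ (Fin m)) G] [Group G]
    (z : EuclideanSpace ℝ (Fin m) × EuclideanSpace ℝ (Fin m)) : EuclideanSpace ℝ (Fin m) :=
  extChartAt (𝓡 m) (1 : G)
    ((extChartAt (𝓡 m) (1 : G)).symm z.1 * (extChartAt (𝓡 m) (1 : G)).symm z.2)

variable [LieGroup (𝓡 m) ∞ G]

lemma contDiffAt_chartMul :
    ContDiffAt ℝ ∞ (chartMul m G) (extChartAt (𝓡 m) (1 : G) 1, extChartAt (𝓡 m) (1 : G) 1) := by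
  rw [← contMDiffAt_iff_contDiffAt]
  have hs : ContMDiffAt 𝓘(ℝ, EuclideanSpace ℝ (Fin m)) (𝓡 m) ∞ (extChartAt (𝓡 m) (1 : G)).symm
      (extChartAt (𝓡 m) (1 : G) 1) :=
    (contMDiffOn_extChartAt_symm (1 : G)).contMDiffAt (extChartAt_target_mem_nhds 1)
  have h1 : ContMDiffAt 𝓘(ℝ, EuclideanSpace ℝ (Fin m) × EuclideanSpace ℝ (Fin m)) (𝓡 m) ∞
      (fun z : EuclideanSpace ℝ (Fin m) × EuclideanSpace ℝ (Fin m) =>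
        (extChartAt (𝓡 m) (1 : G)).symm z.1 * (extChartAt (𝓡 m) (1 : G)).symm z.2)
      (extChartAt (𝓡 m) (1 : G) 1, extChartAt (𝓡 m) (1 : G) 1) := by
    refine ContMDiffAt.mul ?_ ?_
    · exact ContMDiffAt.comp (extChartAt (𝓡 m) (1 : G) 1, extChartAt (𝓡 m) (1 : G) 1)
        (f := Prod.fst) hs contDiff_fst.contMDiff.contMDiffAt
    · exact ContMDiffAt.comp (extChartAt (𝓡 m) (1 : G) 1, extChartAt (𝓡 m) (1 : G) 1)
        (f := Prod.snd) hs contDiff_snd.contMDiff.contMDiffAt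
  refine ContMDiffAt.comp _ ?_ h1
  simp only [extChartAt_to_inv, mul_one]
  exact contMDiffAt_extChartAt

/-- Differentiability of the multiplication in the chart along the two axes near the identity. -/
lemma eventually_differentiableAt_chartMul :
    ∀ᶠ ξ in 𝓝 (extChartAt (𝓡 m) (1 : G) 1), ξ ∈ (extChartAt (𝓡 m) (1 : G)).target ∧
      DifferentiableAt ℝ (chartMul m G) (ξ, extChartAt (𝓡 m) (1 : G) 1) ∧
      DifferentiableAt ℝ (chartMul m G) (extChartAt (𝓡 m) (1 : G) 1, ξ) := by
  have h := ((contDiffAt_chartMul (m := m) (G := G)).of_le (m := 1) (by simp)).eventually (by simp)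
  have h' : ∀ᶠ z in 𝓝 (extChartAt (𝓡 m) (1 : G) 1, extChartAt (𝓡 m) (1 : G) 1),
      DifferentiableAt ℝ (chartMul m G) z :=
    h.mono fun z hz => hz.differentiableAt (by simp)
  filter_upwards [extChartAt_target_mem_nhds (I := 𝓡 m) (1 : G),
    (Continuous.prodMk_left (extChartAt (𝓡 m) (1 : G) 1)).continuousAt.eventually h',
    (Continuous.prodMk_right (extChartAt (𝓡 m) (1 : G) 1)).continuousAt.eventually h']
    with ξ h1 h2 h3
  exact ⟨h1, h2, h3⟩

end UnitChart

/-! ### The derivative of Ad at the identity is the Lie bracket. -/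

section AdDerivative

open Filter
open scoped Topology

local notation "𝔼" m => EuclideanSpace ℝ (Fin m)

variable {m : ℕ} {G : Type*} [TopologicalSpace G] [ChartedSpace (𝔼 m) G]
  [Group G]

lemma Ad_eq (x : G) (Y : GroupLieAlgebra (𝓡 m) G) :
    Ad x Y = flatDeriv m m (fun z : G => x * z * x⁻¹) 1 Y := rfl

variable [LieGroup (𝓡 m) ∞ G]

lemma mdifferentiableAt_mul_left' (x y : G) :
    MDifferentiableAt (𝓡 m) (𝓡 m) (fun z : G => x * z) y :=
  (contMDiff_mul_left (I := 𝓡 m) (n := ∞)).mdifferentiableAt (by simp)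

lemma mdifferentiableAt_mul_right' (x y : G) :
    MDifferentiableAt (𝓡 m) (𝓡 m) (fun z : G => z * x) y :=
  (contMDiff_mul_right (I := 𝓡 m) (n := ∞)).mdifferentiableAt (by simp)

lemma mdifferentiableAt_conj (x y : G) :
    MDifferentiableAt (𝓡 m) (𝓡 m) (fun z : G => x * z * x⁻¹) y :=
  (mdifferentiableAt_mul_right' x⁻¹ (x * y)).comp y (mdifferentiableAt_mul_left' x y)

/-- The derivative of right translation maps `Ad(x) Y` to the left-invariant field of `Y`. -/
lemma flatDeriv_mul_right_Ad (x : G) (Y : GroupLieAlgebra (𝓡 m) G) :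
    flatDeriv m m (fun z : G => z * x) 1 (Ad x Y) =
      flatDeriv m m (fun z : G => x * z) 1 Y := by
  have h1 : (fun z : G => x * z) = fun z => x * z * x⁻¹ * x := by
    ext z; simp
  rw [Ad_eq]
  conv_rhs => rw [h1]
  rw [flatDeriv_comp (g := fun z : G => z * x) (f := fun z : G => x * z * x⁻¹)
    (mdifferentiableAt_mul_right' x _) (mdifferentiableAt_conj x 1)]
  simp only [mul_one, mul_inv_cancel]
  rfl

/-- The partial derivative in the second factor is left translation, so it is the left-invariant
field of X read in the chart. -/
lemma fderiv_chartMul_right {ξ : 𝔼 m} (hξ : ξ ∈ (extChartAt (𝓡 m) (1 : G)).target)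
    (hd : DifferentiableAt ℝ (chartMul m G) (ξ, extChartAt (𝓡 m) (1 : G) 1)) (X : 𝔼 m) :
    fderiv ℝ (chartMul m G) (ξ, extChartAt (𝓡 m) (1 : G) 1) (0, X) =
      flatDeriv m m (extChartAt (𝓡 m) (1 : G)) ((extChartAt (𝓡 m) (1 : G)).symm ξ)
        (flatDeriv m m (fun z : G => (extChartAt (𝓡 m) (1 : G)).symm ξ * z) 1 X) := by
  set c := extChartAt (𝓡 m) (1 : G) with hc
  set x := c.symm ξ with hx
  have hxs : x ∈ c.source := c.map_target hξ
  have hc1 : c.symm (c 1) = 1 := extChartAt_to_inv (I := 𝓡 m) (1 : G)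
  have h1 : HasFDerivAt (fun η => chartMul m G (ξ, η))
      ((fderiv ℝ (chartMul m G) (ξ, c 1)).comp (ContinuousLinearMap.inr ℝ _ _)) (c 1) :=
    hd.hasFDerivAt.comp (c 1) (hasFDerivAt_prodMk_right ξ (c 1))
  have e1 : MDifferentiableAt (𝓡 m) (𝓡 m) c.symm (c 1) :=
    mdifferentiableAt_extChartAt_symm (mem_extChartAt_target (1 : G))
  have e3 : MDifferentiableAt (𝓡 m) (𝓡 m) c (x * c.symm (c 1)) := by
    refine mdifferentiableAt_extChartAt ?_
    rwa [hc1, mul_one, ← extChartAt_source (𝓡 m)]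
  have h2 : flatDeriv m m (fun η => chartMul m G (ξ, η)) (c 1) =
      (flatDeriv m m c x).comp (flatDeriv m m (fun z => x * z) 1) := by
    have h3 := flatDeriv_comp (k := m) (f := fun η => x * c.symm η) (g := c) (x := c 1) e3
      ((mdifferentiableAt_mul_left' x _).comp (c 1) e1)
    rw [flatDeriv_comp (f := c.symm) (g := fun z => x * z) (mdifferentiableAt_mul_left' x _) e1,
      flatDeriv_extChartAt_symm_self, hc1, mul_one] at h3
    exact h3
  rw [flatDeriv_eq_fderiv, h1.fderiv] at h2
  exact DFunLike.congr_fun h2 X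

lemma fderiv_chartMul_left {ξ : 𝔼 m} (hξ : ξ ∈ (extChartAt (𝓡 m) (1 : G)).target)
    (hd : DifferentiableAt ℝ (chartMul m G) (extChartAt (𝓡 m) (1 : G) 1, ξ)) (X : 𝔼 m) :
    fderiv ℝ (chartMul m G) (extChartAt (𝓡 m) (1 : G) 1, ξ) (X, 0) =
      flatDeriv m m (extChartAt (𝓡 m) (1 : G)) ((extChartAt (𝓡 m) (1 : G)).symm ξ)
        (flatDeriv m m (fun z : G => z * (extChartAt (𝓡 m) (1 : G)).symm ξ) 1 X) := by
  set c := extChartAt (𝓡 m) (1 : G) with hc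
  set x := c.symm ξ with hx
  have hxs : x ∈ c.source := c.map_target hξ
  have hc1 : c.symm (c 1) = 1 := extChartAt_to_inv (I := 𝓡 m) (1 : G)
  have h1 : HasFDerivAt (fun η => chartMul m G (η, ξ))
      ((fderiv ℝ (chartMul m G) (c 1, ξ)).comp (ContinuousLinearMap.inl ℝ _ _)) (c 1) :=
    HasFDerivAt.comp (f := fun η => (η, ξ)) (c 1) hd.hasFDerivAt (hasFDerivAt_prodMk_left (c 1) ξ)
  have e1 : MDifferentiableAt (𝓡 m) (𝓡 m) c.symm (c 1) :=
    mdifferentiableAt_extChartAt_symm (mem_extChartAt_target (1 : G))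
  have e3 : MDifferentiableAt (𝓡 m) (𝓡 m) c (c.symm (c 1) * x) := by
    refine mdifferentiableAt_extChartAt ?_
    rwa [hc1, one_mul, ← extChartAt_source (𝓡 m)]
  have h2 : flatDeriv m m (fun η => chartMul m G (η, ξ)) (c 1) =
      (flatDeriv m m c x).comp (flatDeriv m m (fun z => z * x) 1) := by
    have h3 := flatDeriv_comp (k := m) (f := fun η => c.symm η * x) (g := c) (x := c 1) e3
      ((mdifferentiableAt_mul_right' x _).comp (c 1) e1)
    rw [flatDeriv_comp (f := c.symm) (g := fun z => z * x) (mdifferentiableAt_mul_right' x _) e1,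
      flatDeriv_extChartAt_symm_self, hc1, one_mul] at h3
    exact h3
  rw [flatDeriv_eq_fderiv, h1.fderiv] at h2
  exact DFunLike.congr_fun h2 X

/-- `dR_x (Ad(x) Y) = Y^L(x)` read in the chart at the identity. -/
lemma eventually_fderiv_chartMul_Ad (Y : 𝔼 m) :
    ∀ᶠ ξ in 𝓝 (extChartAt (𝓡 m) (1 : G) 1),
      fderiv ℝ (chartMul m G) (extChartAt (𝓡 m) (1 : G) 1, ξ)
        (flatDeriv m m (fun z : G => (extChartAt (𝓡 m) (1 : G)).symm ξ * z *
          ((extChartAt (𝓡 m) (1 : G)).symm ξ)⁻¹) 1 Y, 0) =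
      fderiv ℝ (chartMul m G) (ξ, extChartAt (𝓡 m) (1 : G) 1) (0, Y) := by
  filter_upwards [eventually_differentiableAt_chartMul (m := m) (G := G)] with ξ hξ
  rw [fderiv_chartMul_left hξ.1 hξ.2.2, fderiv_chartMul_right hξ.1 hξ.2.1]
  exact congrArg _ (flatDeriv_mul_right_Ad _ Y)

lemma fderiv_chartMul_right_self (X : 𝔼 m) :
    fderiv ℝ (chartMul m G) (extChartAt (𝓡 m) (1 : G) 1, extChartAt (𝓡 m) (1 : G) 1) (0, X) =
      X := by
  have h := (eventually_differentiableAt_chartMul (m := m) (G := G)).self_of_nhds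
  rw [fderiv_chartMul_right h.1 h.2.1, extChartAt_to_inv, flatDeriv_extChartAt_self]
  simp [flatDeriv_id]

lemma fderiv_chartMul_left_self (X : 𝔼 m) :
    fderiv ℝ (chartMul m G) (extChartAt (𝓡 m) (1 : G) 1, extChartAt (𝓡 m) (1 : G) 1) (X, 0) =
      X := by
  have h := (eventually_differentiableAt_chartMul (m := m) (G := G)).self_of_nhds
  rw [fderiv_chartMul_left h.1 h.2.2, extChartAt_to_inv, flatDeriv_extChartAt_self]
  simp [flatDeriv_id]

/-- The Lie bracket of `Lie(G)`, as an operation on the model space. -/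
noncomputable def flatBracket (m : ℕ) (G : Type*) [TopologicalSpace G] [ChartedSpace (𝔼 m) G]
    [Group G] (X Y : 𝔼 m) : 𝔼 m :=
  Bracket.bracket (L := GroupLieAlgebra (𝓡 m) G) (M := GroupLieAlgebra (𝓡 m) G) X Y

lemma flatBracket_eq_fderiv_chartMul (X Y : 𝔼 m) :
    flatBracket m G X Y =
      fderiv ℝ (fun ξ => fderiv ℝ (chartMul m G) (ξ, extChartAt (𝓡 m) (1 : G) 1)
          (0, Y)) (extChartAt (𝓡 m) (1 : G) 1) X
        - fderiv ℝ (fun ξ => fderiv ℝ (chartMul m G) (ξ, extChartAt (𝓡 m) (1 : G) 1)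
          (0, X)) (extChartAt (𝓡 m) (1 : G) 1) Y := by
  let P : (𝔼 m) → (𝔼 m) → 𝔼 m := fun Z => mpullbackWithin (𝓡 m) (𝓡 m)
    (extChartAt (𝓡 m) (1 : G)).symm (mulInvariantVectorField Z) (Set.range (𝓡 m))
  have h : ∀ Z, P Z =ᶠ[𝓝 (extChartAt (𝓡 m) (1 : G) 1)]
      fun ξ => fderiv ℝ (chartMul m G) (ξ, extChartAt (𝓡 m) (1 : G) 1) (0, Z) := by
    intro Z
    filter_upwards [eventually_differentiableAt_chartMul (m := m) (G := G)] with ξ hξ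
    exact (mpullbackWithin_extChartAt_symm _ hξ.1).trans
      (fderiv_chartMul_right hξ.1 hξ.2.1 Z).symm
  have hb : flatBracket m G X Y = lieBracketWithin ℝ (P X) (P Y)
      ((extChartAt (𝓡 m) (1 : G)).symm ⁻¹' Set.univ ∩ Set.range (𝓡 m))
      (extChartAt (𝓡 m) (1 : G) 1) := by
    have hi : (ContinuousLinearMap.inverse (flatDeriv m m (extChartAt (𝓡 m) (1 : G)) 1)) =
        ContinuousLinearMap.id ℝ (𝔼 m) := by
      rw [flatDeriv_extChartAt_self, ContinuousLinearMap.inverse_id]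
    exact DFunLike.congr_fun hi _
  clear_value P
  rw [ModelWithCorners.range_eq_univ, Set.preimage_univ, Set.inter_univ, lieBracketWithin_univ,
    lieBracket] at hb
  rw [(h X).fderiv_eq, (h Y).fderiv_eq, (h X).eq_of_nhds, (h Y).eq_of_nhds,
    fderiv_chartMul_right_self, fderiv_chartMul_right_self] at hb
  exact hb

/-- The derivative of `x ↦ Ad(x) Y` at the identity is `X ↦ [X, Y]`, in the chart. -/
lemma exists_hasFDerivAt_Ad_chart (Y : 𝔼 m) :
    ∃ D : (𝔼 m) →L[ℝ] 𝔼 m, HasFDerivAt (fun ξ => flatDeriv m m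
        (fun z : G => (extChartAt (𝓡 m) (1 : G)).symm ξ * z *
          ((extChartAt (𝓡 m) (1 : G)).symm ξ)⁻¹) 1 Y) D (extChartAt (𝓡 m) (1 : G) 1) ∧
      ∀ X, D X = flatBracket m G X Y := by
  set p := extChartAt (𝓡 m) (1 : G) 1 with hp
  set a : (𝔼 m) → 𝔼 m := fun ξ => flatDeriv m m
        (fun z : G => (extChartAt (𝓡 m) (1 : G)).symm ξ * z *
          ((extChartAt (𝓡 m) (1 : G)).symm ξ)⁻¹) 1 Y with ha
  have hF : ContDiffAt ℝ 2 (chartMul m G) (p, p) :=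
    contDiffAt_chartMul.of_le ENat.LEInfty.out
  have hF' : HasFDerivAt (fderiv ℝ (chartMul m G)) (fderiv ℝ (fderiv ℝ (chartMul m G)) (p, p))
      (p, p) :=
    ((hF.fderiv_right (m := 1) (by norm_num)).differentiableAt (by simp)).hasFDerivAt
  have hsymm := hF.isSymmSndFDerivAt (by simp)
  set F2 := fderiv ℝ (fderiv ℝ (chartMul m G)) (p, p) with hF2
  have hr : ∀ Z : 𝔼 m, HasFDerivAt (fun ξ => fderiv ℝ (chartMul m G) (ξ, p) (0, Z))
      ((ContinuousLinearMap.apply ℝ (𝔼 m) ((0, Z) : (𝔼 m) × 𝔼 m)).comp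
        (F2.comp (ContinuousLinearMap.inl ℝ _ _))) p := fun Z =>
    (ContinuousLinearMap.hasFDerivAt
      (ContinuousLinearMap.apply ℝ (𝔼 m) ((0, Z) : (𝔼 m) × 𝔼 m))).comp p (HasFDerivAt.comp (f := fun ξ => (ξ, p)) p hF' (hasFDerivAt_prodMk_left p p))
  -- N is right translation in the chart, and N(ξ) a(ξ) is the left-invariant field of Y. Since N is
  -- the identity at p, it is invertible nearby, and solving for a shows that a is differentiable at
  -- p.
  let N : (𝔼 m) → ((𝔼 m) →L[ℝ] 𝔼 m) := fun ξ =>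
    (fderiv ℝ (chartMul m G) (p, ξ)).comp (ContinuousLinearMap.inl ℝ (𝔼 m) (𝔼 m))
  have hN : HasFDerivAt N
      (((ContinuousLinearMap.compL ℝ (𝔼 m) ((𝔼 m) × 𝔼 m) (𝔼 m)).flip
        (ContinuousLinearMap.inl ℝ (𝔼 m) (𝔼 m))).comp
        (F2.comp (ContinuousLinearMap.inr ℝ _ _))) p :=
    (ContinuousLinearMap.hasFDerivAt ((ContinuousLinearMap.compL ℝ (𝔼 m) ((𝔼 m) × 𝔼 m)
      (𝔼 m)).flip (ContinuousLinearMap.inl ℝ (𝔼 m) (𝔼 m)))).comp p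
      (HasFDerivAt.comp (f := fun ξ => (p, ξ)) p hF' (hasFDerivAt_prodMk_right p p))
  have hNp : N p = ContinuousLinearMap.id ℝ (𝔼 m) := by
    ext1 X
    exact fderiv_chartMul_left_self X
  have hNa : ∀ᶠ ξ in 𝓝 p, N ξ (a ξ) = fderiv ℝ (chartMul m G) (ξ, p) (0, Y) :=
    eventually_fderiv_chartMul_Ad Y
  have hinv : DifferentiableAt ℝ
      (ContinuousLinearMap.inverse : ((𝔼 m) →L[ℝ] 𝔼 m) → (𝔼 m) →L[ℝ] 𝔼 m) (N p) := by
    rw [hNp]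
    exact (contDiffAt_map_inverse (n := 1) (ContinuousLinearEquiv.refl ℝ (𝔼 m))).differentiableAt
      (by simp)
  have hNinv : ∀ᶠ ξ in 𝓝 p, N ξ ∈ Set.range ((↑) : ((𝔼 m) ≃L[ℝ] 𝔼 m) → (𝔼 m) →L[ℝ] 𝔼 m) := by
    refine hN.continuousAt.eventually ?_
    rw [hNp]
    exact ContinuousLinearEquiv.nhds (ContinuousLinearEquiv.refl ℝ (𝔼 m))
  have ha_eq : a =ᶠ[𝓝 p] fun ξ =>
      ContinuousLinearMap.inverse (N ξ) (fderiv ℝ (chartMul m G) (ξ, p) (0, Y)) := by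
    filter_upwards [hNa, hNinv] with ξ h1 h2
    obtain ⟨e, he⟩ := h2
    rw [← h1, ← he, ContinuousLinearMap.inverse_equiv]
    simp
  have had : DifferentiableAt ℝ a p := by
    refine DifferentiableAt.congr_of_eventuallyEq ?_ ha_eq
    exact (hinv.comp p hN.differentiableAt).clm_apply (hr Y).differentiableAt
  refine ⟨fderiv ℝ a p, had.hasFDerivAt, fun X => ?_⟩
  have hap : a p = Y := by
    rw [ha_eq.eq_of_nhds, hNp, ContinuousLinearMap.inverse_id]
    exact fderiv_chartMul_right_self Y
  -- Differentiating N a at p leaves two mixed second derivatives of the multiplication; by symmetry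
  -- their difference is the bracket.
  have h1 := (hN.clm_apply had.hasFDerivAt).unique ((hr Y).congr_of_eventuallyEq hNa)
  have h2 := DFunLike.congr_fun h1 X
  have h3 : fderiv ℝ a p X + F2 (0, X) (Y, 0) = F2 (X, 0) (0, Y) := by
    rw [hNp, hap] at h2
    exact h2
  rw [flatBracket_eq_fderiv_chartMul, ← hp, (hr Y).fderiv, (hr X).fderiv]
  have h4 : F2 (0, X) (Y, 0) = F2 (Y, 0) (0, X) := hsymm.eq _ _
  rw [h4] at h3
  exact eq_sub_of_add_eq h3

end AdDerivative

/-! ### Ad as a representation, homomorphisms and invariant inner products. -/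

section AdjointAction

open Filter
open scoped Topology

local notation "𝔼" m => EuclideanSpace ℝ (Fin m)

variable {m : ℕ} {G : Type*} [TopologicalSpace G] [ChartedSpace (𝔼 m) G] [Group G]

/-- The adjoint action on the model space. -/
noncomputable def adj (m : ℕ) {G : Type*} [TopologicalSpace G] [ChartedSpace (𝔼 m) G] [Group G]
    (x : G) : (𝔼 m) →L[ℝ] 𝔼 m :=
  flatDeriv m m (fun z : G => x * z * x⁻¹) 1

lemma adj_one : adj m (1 : G) = ContinuousLinearMap.id ℝ (𝔼 m) := by
  simp [adj, flatDeriv_id]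

variable [LieGroup (𝓡 m) ∞ G]

lemma adj_mul (x y : G) : adj m (x * y) = (adj m x).comp (adj m y) := by
  have h : (fun z : G => x * y * z * (x * y)⁻¹) = fun z => x * (y * z * y⁻¹) * x⁻¹ := by
    ext z; group
  rw [adj, h, flatDeriv_comp (f := fun z : G => y * z * y⁻¹) (g := fun z : G => x * z * x⁻¹)
    (mdifferentiableAt_conj x _) (mdifferentiableAt_conj y 1)]
  simp only [mul_one, mul_inv_cancel]
  rfl

lemma adj_inv_apply (x : G) (Y : 𝔼 m) : adj m x⁻¹ (adj m x Y) = Y := by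
  rw [← ContinuousLinearMap.comp_apply, ← adj_mul, inv_mul_cancel, adj_one]
  rfl

lemma adj_apply_inv (x : G) (Y : 𝔼 m) : adj m x (adj m x⁻¹ Y) = Y := by
  rw [← ContinuousLinearMap.comp_apply, ← adj_mul, mul_inv_cancel, adj_one]
  rfl

lemma mdifferentiableAt_adj_and_flatDeriv (Y : 𝔼 m) :
    MDifferentiableAt (𝓡 m) (𝓡 m) (fun x : G => adj m x Y) 1 ∧
      ∀ X, flatDeriv m m (fun x : G => adj m x Y) 1 X = flatBracket m G X Y := by
  obtain ⟨D, hD, hDb⟩ := exists_hasFDerivAt_Ad_chart (m := m) (G := G) Y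
  set c := extChartAt (𝓡 m) (1 : G) with hc
  let a : (𝔼 m) → 𝔼 m := fun ξ => adj m (c.symm ξ) Y
  have ha : HasFDerivAt a D (c 1) := hD
  have ha' : MDifferentiableAt (𝓡 m) (𝓡 m) a (c 1) := ha.differentiableAt.mdifferentiableAt
  have hc' : MDifferentiableAt (𝓡 m) (𝓡 m) c (1 : G) :=
    mdifferentiableAt_extChartAt (mem_chart_source _ _)
  have heq : (fun x : G => adj m x Y) =ᶠ[𝓝 1] fun x => a (c x) := by
    filter_upwards [extChartAt_source_mem_nhds (I := 𝓡 m) (1 : G)] with x hx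
    simp only [a]
    rw [c.left_inv hx]
  refine ⟨MDifferentiableAt.congr_of_eventuallyEq (ha'.comp 1 hc') heq, fun X => ?_⟩
  have h1 : flatDeriv m m (fun x : G => adj m x Y) 1 = flatDeriv m m (fun x => a (c x)) 1 :=
    heq.mfderiv_eq
  rw [h1, flatDeriv_comp ha' hc', hc, flatDeriv_extChartAt_self, ← hc, flatDeriv_eq_fderiv,
    ha.fderiv, ContinuousLinearMap.comp_id, hDb]

lemma mdifferentiableAt_adj (Y : 𝔼 m) :
    MDifferentiableAt (𝓡 m) (𝓡 m) (fun x : G => adj m x Y) 1 :=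
  (mdifferentiableAt_adj_and_flatDeriv Y).1

/-- The derivative of the adjoint action is the adjoint representation. -/
lemma flatDeriv_adj (X Y : 𝔼 m) :
    flatDeriv m m (fun x : G => adj m x Y) 1 X = flatBracket m G X Y :=
  (mdifferentiableAt_adj_and_flatDeriv Y).2 X

/-- Continuity at the identity is carried to every x by Ad(y) = Ad(x) Ad(x⁻¹y). -/
lemma continuous_adj (Y : 𝔼 m) : Continuous (fun x : G => adj m x Y) := by
  have := topologicalGroup_of_lieGroup (𝓡 m) ∞ (G := G)
  refine continuous_iff_continuousAt.mpr fun x => ?_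
  have h : (fun y : G => adj m y Y) = fun y => adj m x (adj m (x⁻¹ * y) Y) := by
    ext1 y
    rw [← ContinuousLinearMap.comp_apply, ← adj_mul, mul_inv_cancel_left]
  rw [h]
  refine (adj m x).continuous.continuousAt.comp ?_
  have h1 : ContinuousAt (fun z : G => adj m z Y) (x⁻¹ * x) := by
    rw [inv_mul_cancel]
    exact (mdifferentiableAt_adj Y).continuousAt
  exact h1.comp (f := fun y : G => x⁻¹ * y) (continuous_const_mul _).continuousAt

section Hom

variable {l : ℕ} {H : Type*} [TopologicalSpace H] [ChartedSpace (𝔼 l) H] [Group H]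
  [LieGroup (𝓡 l) ∞ H]

lemma flatDeriv_hom_adj (f : H →* G) (hf : MDifferentiable (𝓡 l) (𝓡 m) f) (x : H) (Y : 𝔼 l) :
    flatDeriv l m f 1 (adj l x Y) = adj m (f x) (flatDeriv l m f 1 Y) := by
  have h : (fun z => f (x * z * x⁻¹)) = fun z => f x * f z * (f x)⁻¹ := by
    ext z; simp
  have h1 : flatDeriv l m (fun z => f (x * z * x⁻¹)) 1 = (flatDeriv l m f 1).comp (adj l x) := by
    rw [flatDeriv_comp (f := fun z => x * z * x⁻¹) (g := f) (hf _) (mdifferentiableAt_conj x 1)]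
    simp only [mul_one, mul_inv_cancel]
    rfl
  have h2 : flatDeriv l m (fun z => f x * f z * (f x)⁻¹) 1 =
      (adj m (f x)).comp (flatDeriv l m f 1) := by
    rw [flatDeriv_comp (f := f) (g := fun z => f x * z * (f x)⁻¹) (mdifferentiableAt_conj _ _)
      (hf _), map_one]
    rfl
  rw [h, h2] at h1
  exact (DFunLike.congr_fun h1 Y).symm

/-- The derivative of a homomorphism of Lie groups is a homomorphism of Lie algebras. -/
lemma flatDeriv_hom_flatBracket (f : H →* G) (hf : MDifferentiable (𝓡 l) (𝓡 m) f) (X Y : 𝔼 l) :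
    flatDeriv l m f 1 (flatBracket l H X Y) =
      flatBracket m G (flatDeriv l m f 1 X) (flatDeriv l m f 1 Y) := by
  -- Differentiating this equality in x at the identity turns both adjoint actions into brackets.
  have h : (fun x : H => flatDeriv l m f 1 (adj l x Y)) =
      fun x => adj m (f x) (flatDeriv l m f 1 Y) := by
    ext1 x
    exact flatDeriv_hom_adj f hf x Y
  have h1 : flatDeriv l m (fun x : H => flatDeriv l m f 1 (adj l x Y)) 1 =
      (flatDeriv l m f 1).comp (flatDeriv l l (fun x : H => adj l x Y) 1) := by
    rw [flatDeriv_comp (f := fun x : H => adj l x Y) (g := fun Z => flatDeriv l m f 1 Z)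
      ((flatDeriv l m f 1).differentiableAt.mdifferentiableAt) (mdifferentiableAt_adj Y),
      flatDeriv_eq_fderiv]
    congr 1
    exact (flatDeriv l m f 1).fderiv
  have h2 : flatDeriv l m (fun x : H => adj m (f x) (flatDeriv l m f 1 Y)) 1 =
      (flatDeriv m m (fun x : G => adj m x (flatDeriv l m f 1 Y)) 1).comp (flatDeriv l m f 1) := by
    have h3 : MDifferentiableAt (𝓡 m) (𝓡 m) (fun x : G => adj m x (flatDeriv l m f 1 Y)) (f 1) := by
      rw [map_one]
      exact mdifferentiableAt_adj _
    rw [flatDeriv_comp (f := f) (g := fun x : G => adj m x (flatDeriv l m f 1 Y)) h3 (hf _),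
      map_one]
  rw [h, h2] at h1
  have h4 := DFunLike.congr_fun h1 X
  rw [ContinuousLinearMap.comp_apply, ContinuousLinearMap.comp_apply, flatDeriv_adj,
    flatDeriv_adj] at h4
  exact h4.symm

end Hom

lemma adj_flatBracket (x : G) (X Y : 𝔼 m) :
    adj m x (flatBracket m G X Y) = flatBracket m G (adj m x X) (adj m x Y) :=
  flatDeriv_hom_flatBracket (MulAut.conj x).toMonoidHom (fun y => mdifferentiableAt_conj x y) X Y

/-- An `Ad`-invariant bilinear form is invariant under the adjoint representation. -/
lemma invariant_of_adj (b : LinearMap.BilinForm ℝ (𝔼 m))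
    (hb : ∀ (x : G) X Y, b (adj m x X) (adj m x Y) = b X Y) (Z X Y : 𝔼 m) :
    b (flatBracket m G Z X) Y = -b X (flatBracket m G Z Y) := by
  let B : (𝔼 m) →L[ℝ] (𝔼 m) →L[ℝ] ℝ := b.toContinuousBilinearMap
  have h1 : HasMFDerivAt (𝓡 m) (𝓡 m) (fun x : G => adj m x X) 1
      (flatDeriv m m (fun x : G => adj m x X) 1) := (mdifferentiableAt_adj X).hasMFDerivAt
  have h2 : HasMFDerivAt (𝓡 m) (𝓡 m) (fun x : G => adj m x Y) 1
      (flatDeriv m m (fun x : G => adj m x Y) 1) := (mdifferentiableAt_adj Y).hasMFDerivAt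
  have h3 : HasMFDerivAt (𝓡 m) 𝓘(ℝ, (𝔼 m) × (𝔼 m)) (fun x : G => (adj m x X, adj m x Y)) 1
      ((flatDeriv m m (fun x : G => adj m x X) 1).prod
        (flatDeriv m m (fun x : G => adj m x Y) 1)) := ⟨h1.1.prodMk h2.1, h1.2.prodMk h2.2⟩
  have h4 := (B.isBoundedBilinearMap.hasFDerivAt (adj m (1 : G) X, adj m (1 : G) Y)).hasMFDerivAt
  have h5 := HasMFDerivAt.comp (1 : G) h4 h3
  have h6 : (fun z : (𝔼 m) × (𝔼 m) => B z.1 z.2) ∘ (fun x : G => (adj m x X, adj m x Y)) =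
      fun _ => b X Y := by
    ext1 x
    exact hb x X Y
  rw [h6] at h5
  have h7 := DFunLike.congr_fun (hasMFDerivAt_unique h5 (hasMFDerivAt_const _ _)) Z
  have h8 : B (adj m (1 : G) X) (flatDeriv m m (fun x : G => adj m x Y) 1 Z) +
      B (flatDeriv m m (fun x : G => adj m x X) 1 Z) (adj m (1 : G) Y) = 0 := h7
  rw [flatDeriv_adj, flatDeriv_adj, adj_one] at h8
  have h9 : b X (flatBracket m G Z Y) + b (flatBracket m G Z X) Y = 0 := h8
  linarith

open MeasureTheory in
/-- A compact Lie group has an `Ad`-invariant inner product on its Lie algebra. -/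
lemma exists_adj_invariant_inner [CompactSpace G] :
    ∃ b : LinearMap.BilinForm ℝ (𝔼 m), IsInner b ∧
      ∀ (x : G) X Y, b (adj m x X) (adj m x Y) = b X Y := by
  have := topologicalGroup_of_lieGroup (𝓡 m) ∞ (G := G)
  let _ : MeasurableSpace G := borel G
  have : BorelSpace G := ⟨rfl⟩
  let μ : Measure G := Measure.haar
  have hc : ∀ X Y : 𝔼 m, Continuous fun x : G => inner ℝ (adj m x⁻¹ X) (adj m x⁻¹ Y) :=
    fun X Y => ((continuous_adj X).comp continuous_inv).inner
      ((continuous_adj Y).comp continuous_inv)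
  have hi : ∀ X Y : 𝔼 m, Integrable (fun x : G => inner ℝ (adj m x⁻¹ X) (adj m x⁻¹ Y)) μ :=
    fun X Y => (hc X Y).integrable_of_hasCompactSupport (HasCompactSupport.of_compactSpace _)
  -- The inverse in the integrand makes invariance a consequence of left invariance of Haar measure.
  let b : LinearMap.BilinForm ℝ (𝔼 m) := LinearMap.mk₂ ℝ
    (fun X Y => ∫ x : G, inner ℝ (adj m x⁻¹ X) (adj m x⁻¹ Y) ∂μ)
    (fun X X' Y => by
      simp only [map_add, inner_add_left]
      exact integral_add (hi X Y) (hi X' Y))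
    (fun c X Y => by
      simp only [map_smul, real_inner_smul_left]
      exact integral_const_mul _ _)
    (fun X Y Y' => by
      simp only [map_add, inner_add_right]
      exact integral_add (hi X Y) (hi X Y'))
    (fun c X Y => by
      simp only [map_smul, real_inner_smul_right]
      exact integral_const_mul _ _)
  refine ⟨b, ⟨fun X Y => ?_, fun X hX => ?_⟩, fun y X Y => ?_⟩
  · exact integral_congr_ae (ae_of_all _ fun x => real_inner_comm _ _)
  · refine (hc X X).integral_pos_of_hasCompactSupport_nonneg_nonzero
      (HasCompactSupport.of_compactSpace _) (fun x => real_inner_self_nonneg) (x := 1) ?_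
    rw [inv_one, adj_one]
    exact inner_self_ne_zero.mpr hX
  · have h := integral_mul_left_eq_self (μ := μ)
      (fun x : G => (inner ℝ (adj m x⁻¹ X) (adj m x⁻¹ Y) : ℝ)) y⁻¹
    simp only [mul_inv_rev, inv_inv, adj_mul] at h
    exact h

end AdjointAction

/-! ### From left-invariant tensor fields to the Lie algebra. -/

section LeftInvariantRicci

open LieAlgebra

local notation "𝔼" m => EuclideanSpace ℝ (Fin m)

variable {m : ℕ} {G : Type*} [TopologicalSpace G] [ChartedSpace (𝔼 m) G]

lemma dirDeriv_const (X : ∀ x : G, TangentSpace (𝓡 m) x) (r : ℝ) (x : G) :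
    dirDeriv X (fun _ => r) x = 0 := by
  have : mfderiv (𝓡 m) 𝓘(ℝ, ℝ) (fun _ : G => r) x = 0 := mfderiv_const
  rw [dirDeriv, this]
  rfl

variable [Group G]

lemma toLie_sub (x : G) (u v : TangentSpace (𝓡 m) x) : toLie x (u - v) = toLie x u - toLie x v :=
  map_sub (flatDeriv m m (fun z : G => x⁻¹ * z) x) u v

variable [LieGroup (𝓡 m) ∞ G]

lemma toLie_mulInvariantVectorField (X : GroupLieAlgebra (𝓡 m) G) (x : G) :
    toLie x (mulInvariantVectorField X x) = X := by
  have h := flatDeriv_comp (f := fun z : G => x * z) (g := fun z : G => x⁻¹ * z) (x := 1)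
    (mdifferentiableAt_mul_left' (m := m) x⁻¹ _) (mdifferentiableAt_mul_left' (m := m) x 1)
  simp only [inv_mul_cancel_left, flatDeriv_id, mul_one] at h
  exact (DFunLike.congr_fun h X).symm

lemma mulInvariantVectorField_toLie (x : G) (v : TangentSpace (𝓡 m) x) :
    mulInvariantVectorField (toLie x v) x = v := by
  have h := flatDeriv_comp (f := fun z : G => x⁻¹ * z) (g := fun z : G => x * z) (x := x)
    (mdifferentiableAt_mul_left' (m := m) x _) (mdifferentiableAt_mul_left' (m := m) x⁻¹ x)
  simp only [mul_inv_cancel_left, flatDeriv_id, inv_mul_cancel] at h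
  exact (DFunLike.congr_fun h v).symm

lemma leftInvariantTensor_mulInvariantVectorField
    (g : LinearMap.BilinForm ℝ (GroupLieAlgebra (𝓡 m) G)) (X Y : GroupLieAlgebra (𝓡 m) G) (x : G) :
    leftInvariantTensor g x (mulInvariantVectorField X x) (mulInvariantVectorField Y x) =
      g X Y := by
  rw [leftInvariantTensor, toLie_mulInvariantVectorField, toLie_mulInvariantVectorField]

lemma mlieBracket_mulInvariantVectorField (X Y : GroupLieAlgebra (𝓡 m) G) :
    mlieBracket (𝓡 m) (mulInvariantVectorField X) (mulInvariantVectorField Y) =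
      (mulInvariantVectorField ⁅X, Y⁆ : ∀ x : G, TangentSpace (𝓡 m) x) :=
  (mulInvariantVector_mlieBracket X Y).symm

lemma koszul_mulInvariantVectorField
    (g : LinearMap.BilinForm ℝ (GroupLieAlgebra (𝓡 m) G))
    (X Y Z : GroupLieAlgebra (𝓡 m) G) (x : G) :
    koszul (leftInvariantTensor g) (mulInvariantVectorField X) (mulInvariantVectorField Y)
      (mulInvariantVectorField Z) x = g ⁅X, Y⁆ Z - g ⁅X, Z⁆ Y - g ⁅Y, Z⁆ X := by
  simp only [koszul, mlieBracket_mulInvariantVectorField,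
    leftInvariantTensor_mulInvariantVectorField, dirDeriv_const]
  ring

variable {p : Module.End ℝ (GroupLieAlgebra (𝓡 m) G)} {s : ℝ}
  {g : LinearMap.BilinForm ℝ (GroupLieAlgebra (𝓡 m) G)}

lemma leviCivita_mulInvariantVectorField (hg : IsInner g)
    (hk : ∀ X Y Z, 2 * g (connection p s X Y) Z = g ⁅X, Y⁆ Z - g ⁅X, Z⁆ Y - g ⁅Y, Z⁆ X)
    (X Y : GroupLieAlgebra (𝓡 m) G) :
    leviCivita (leftInvariantTensor g) (mulInvariantVectorField X) (mulInvariantVectorField Y) =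
      mulInvariantVectorField (connection p s X Y) := by
  ext1 x
  have hex : ∃ u : TangentSpace (𝓡 m) x, ∀ Z : GroupLieAlgebra (𝓡 m) G,
      2 * leftInvariantTensor g x u (mulInvariantVectorField Z x) =
        koszul (leftInvariantTensor g) (mulInvariantVectorField X) (mulInvariantVectorField Y)
          (mulInvariantVectorField Z) x :=
    ⟨mulInvariantVectorField (connection p s X Y) x, fun Z => by
      rw [leftInvariantTensor_mulInvariantVectorField, koszul_mulInvariantVectorField, hk]⟩
  have hu := Classical.epsilon_spec hex
  change ∀ Z : GroupLieAlgebra (𝓡 m) G, 2 * leftInvariantTensor g x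
    (leviCivita (leftInvariantTensor g) (mulInvariantVectorField X) (mulInvariantVectorField Y) x)
    (mulInvariantVectorField Z x) = _ at hu
  generalize leviCivita (leftInvariantTensor g) (mulInvariantVectorField X)
    (mulInvariantVectorField Y) x = u at hu
  have h : toLie x u = connection p s X Y := by
    rw [← sub_eq_zero]
    apply hg.eq_zero
    -- Testing against the difference itself: positive definiteness makes the Koszul solution
    -- unique, so the choice in `leviCivita` is this one.
    have hu' := hu (toLie x u - connection p s X Y)
    rw [koszul_mulInvariantVectorField, ← hk, leftInvariantTensor,
      toLie_mulInvariantVectorField] at hu'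
    rw [map_sub g, LinearMap.sub_apply]
    linarith
  rw [← h, mulInvariantVectorField_toLie]

lemma ricci_leftInvariantTensor (hp : IsSubalgebraProj p) (hg : IsInner g)
    (hk : ∀ X Y Z, 2 * g (connection p s X Y) Z = g ⁅X, Y⁆ Z - g ⁅X, Z⁆ Y - g ⁅Y, Z⁆ X)
    (x : G) (v w : TangentSpace (𝓡 m) x) :
    ricci (leftInvariantTensor g) x v w =
      -LinearMap.trace ℝ _ (connectionOp p s (toLie x v) * connectionOp p s (toLie x w)) := by
  rw [← sum_coord_connectionCurvature hp s (Module.finBasis ℝ (GroupLieAlgebra (𝓡 m) G))]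
  refine Finset.sum_congr rfl fun i _ => ?_
  simp only [curvature, leviCivita_mulInvariantVectorField hg hk,
    mlieBracket_mulInvariantVectorField, toLie_sub, toLie_mulInvariantVectorField]
  rfl

end LeftInvariantRicci

/-! ### Ad(x) and the inclusion of 𝔨 as Lie algebra maps. -/

section Bundled

open LieAlgebra

local notation "𝔼" m => EuclideanSpace ℝ (Fin m)

variable {m : ℕ} {G : Type*} [TopologicalSpace G] [ChartedSpace (𝔼 m) G] [Group G]
  [LieGroup (𝓡 m) ∞ G]

/-- The Killing form of a compact Lie group with simple Lie algebra is negative definite. -/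
lemma isInner_Q [CompactSpace G] [IsSimple ℝ (GroupLieAlgebra (𝓡 m) G)] :
    IsInner (-killingForm ℝ (GroupLieAlgebra (𝓡 m) G)) := by
  obtain ⟨b, hb, hinv⟩ := exists_adj_invariant_inner (m := m) (G := G)
  let b' : LinearMap.BilinForm ℝ (GroupLieAlgebra (𝓡 m) G) := b
  have hb' : IsInner b' := ⟨hb.symm, hb.pos⟩
  exact isInner_neg_killingForm hb' (invariant_of_adj b hinv) center_trivial_of_isSimple

/-- The adjoint action as an automorphism of the Lie algebra. -/
noncomputable def AdEquiv (x : G) : GroupLieAlgebra (𝓡 m) G ≃ₗ⁅ℝ⁆ GroupLieAlgebra (𝓡 m) G where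
  toFun := adj m x
  map_add' := (adj m x).map_add
  map_smul' := (adj m x).map_smul
  map_lie' {X Y} := adj_flatBracket x X Y
  invFun := adj m x⁻¹
  left_inv := adj_inv_apply x
  right_inv := adj_apply_inv x

variable {l : ℕ} {K : Subgroup G} [ChartedSpace (𝔼 l) K] [LieGroup (𝓡 l) ∞ K]

/-- The inclusion of the Lie algebra of a Lie subgroup, as a homomorphism of Lie algebras. -/
noncomputable def inclLieHom (hK : ContMDiff (𝓡 l) (𝓡 m) ∞ (fun k : K => (k : G))) :
    GroupLieAlgebra (𝓡 l) K →ₗ⁅ℝ⁆ GroupLieAlgebra (𝓡 m) G where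
  __ := inclLie K (m := m) (l := l)
  map_lie' {X Y} := flatDeriv_hom_flatBracket K.subtype (hK.mdifferentiable (by simp)) X Y

lemma inclLie_Ad (hK : ContMDiff (𝓡 l) (𝓡 m) ∞ (fun k : K => (k : G))) (k : K)
    (X : GroupLieAlgebra (𝓡 l) K) :
    inclLie K (m := m) (Ad k X) = Ad (k : G) (inclLie K (m := m) X) :=
  flatDeriv_hom_adj K.subtype (hK.mdifferentiable (by simp)) k X

end Bundled

/-! ### The scalar equation for the ratio x = α₁/α. -/

section DiagonalEquation

lemma exists_ratio_iff {κ A Ta T₁ : ℝ} (hκ0 : 0 < κ) (hκ1 : κ < 1) (hA : 0 < A) (hTa : 0 < Ta)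
    (hT₁ : 0 < T₁) :
    (∃ x : ℝ, 0 < x ∧ Ta * (κ + x ^ 2 * (1 - κ)) = T₁ * (1 + 2 * A - 2 * A * x)) ↔
      Ta * κ < T₁ * (1 + 2 * A) := by
  constructor
  · rintro ⟨x, hx, h⟩
    have h1 : 0 < Ta * (x ^ 2 * (1 - κ)) := by
      have := sub_pos.mpr hκ1
      positivity
    have h2 : 0 < T₁ * (A * x) := by positivity
    nlinarith
  · intro h
    let f : ℝ → ℝ := fun x => Ta * (κ + x ^ 2 * (1 - κ)) - T₁ * (1 + 2 * A - 2 * A * x)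
    have hf : Continuous f := by fun_prop
    -- M is the zero of the right-hand side, so the difference f is positive there; the hypothesis
    -- says f(0) < 0.
    obtain ⟨M, hM⟩ : ∃ M : ℝ, M = (1 + 2 * A) / (2 * A) := ⟨_, rfl⟩
    have hM0 : 0 < M := by rw [hM]; positivity
    have hfM : 0 < f M := by
      have h1 : 1 + 2 * A - 2 * A * M = 0 := by
        rw [hM]; field_simp; ring
      have h2 := sub_pos.mpr hκ1
      simp only [f, h1, mul_zero, sub_zero]
      positivity
    have hf0 : f 0 < 0 := by
      simp only [f]; nlinarith
    obtain ⟨x, hx, hfx⟩ := intermediate_value_Icc hM0.le hf.continuousOn ⟨hf0.le, hfM.le⟩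
    refine ⟨x, lt_of_le_of_ne hx.1 fun h0 => ?_, sub_eq_zero.mp hfx⟩
    rw [← h0] at hfx
    exact hf0.ne hfx

lemma ratio_unique {κ A Ta T₁ x y : ℝ} (hκ1 : κ < 1) (hA : 0 < A) (hTa : 0 < Ta)
    (hT₁ : 0 < T₁) (hx : 0 < x) (hy : 0 < y)
    (h : Ta * (κ + x ^ 2 * (1 - κ)) = T₁ * (1 + 2 * A - 2 * A * x))
    (h' : Ta * (κ + y ^ 2 * (1 - κ)) = T₁ * (1 + 2 * A - 2 * A * y)) : x = y := by
  have h1 : (x - y) * (Ta * (1 - κ) * (x + y) + 2 * T₁ * A) = 0 := by linear_combination h - h'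
  have h2 : 0 < Ta * (1 - κ) * (x + y) + 2 * T₁ * A := by
    have := sub_pos.mpr hκ1
    positivity
  exact sub_eq_zero.mp ((mul_eq_zero.mp h1).resolve_right h2.ne')

end DiagonalEquation

/-! ### The Ricci equation as two scalar equations. -/

section DiagonalMetric

open LieAlgebra

local notation "𝔼" m => EuclideanSpace ℝ (Fin m)

variable {m : ℕ} {G : Type*} [TopologicalSpace G] [ChartedSpace (𝔼 m) G] [Group G]
  [LieGroup (𝓡 m) ∞ G]
  {p : Module.End ℝ (GroupLieAlgebra (𝓡 m) G)}

/-- The Ricci equation for diagonal metrics reduces to one equation on each summand. -/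
lemma solvesPrescribedRicci_iff (hp : IsSubalgebraProj p) {κ A : ℝ}
    (hκ : ∀ v w, p v = v → p w = w → LinearMap.trace ℝ _
      (p * (ad ℝ _ v * ad ℝ _ w)) = κ * killingForm ℝ (GroupLieAlgebra (𝓡 m) G) v w)
    (hA : ∀ v w, p v = 0 → p w = 0 → LinearMap.trace ℝ _
      (p * (ad ℝ _ v * ad ℝ _ w)) = A * killingForm ℝ (GroupLieAlgebra (𝓡 m) G) v w)
    {X₀ Y₀ : GroupLieAlgebra (𝓡 m) G} (hX₀ : X₀ ≠ 0) (hpX₀ : p X₀ = X₀) (hY₀ : Y₀ ≠ 0)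
    (hpY₀ : p Y₀ = 0) {g T : LinearMap.BilinForm ℝ (GroupLieAlgebra (𝓡 m) G)}
    {α α₁ Ta T₁ : ℝ} (hα : 0 < α) (hα₁ : 0 < α₁)
    (hg : ∀ v w, g v w = α * (-killingForm ℝ (GroupLieAlgebra (𝓡 m) G)) (v - p v) (w - p w)
      + α₁ * (-killingForm ℝ (GroupLieAlgebra (𝓡 m) G)) (p v) (p w))
    (hT : ∀ v w, T v w = Ta * (-killingForm ℝ (GroupLieAlgebra (𝓡 m) G)) (v - p v) (w - p w)
      + T₁ * (-killingForm ℝ (GroupLieAlgebra (𝓡 m) G)) (p v) (p w)) :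
    SolvesPrescribedRicci g T ↔ ∃ c : ℝ, 0 < c ∧
      κ + (α₁ / α) ^ 2 * (1 - κ) = 4 * c * T₁ ∧
      1 + 2 * A - 2 * A * (α₁ / α) = 4 * c * Ta := by
  have hq := hp.inner
  obtain ⟨s, hs⟩ : ∃ s : ℝ, 2 * s + 1 = α₁ / α := ⟨(α₁ / α - 1) / 2, by ring⟩
  have hs' : α * (2 * s + 1) = α₁ := by rw [hs]; field_simp
  have hgi : IsInner g := by
    refine ⟨fun x y => by rw [hg, hg, hq.symm, hq.symm (p x)], fun x hx => ?_⟩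
    rw [hg]
    by_cases h : p x = 0
    · rw [h, sub_zero, map_zero, mul_zero, add_zero]
      exact mul_pos hα (hq.pos x hx)
    · exact add_pos_of_nonneg_of_pos (mul_nonneg hα.le (hq.nonneg _)) (mul_pos hα₁ (hq.pos _ h))
  have hric : ∀ (x : G) (v w : TangentSpace (𝓡 m) x), ricci (leftInvariantTensor g) x v w =
      (1 / 4) * (κ + (2 * s + 1) ^ 2 * (1 - κ)) *
        (-killingForm ℝ (GroupLieAlgebra (𝓡 m) G)) (p (toLie x v)) (p (toLie x w))
      + (1 / 4 - s * A) * (-killingForm ℝ (GroupLieAlgebra (𝓡 m) G))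
        (toLie x v - p (toLie x v)) (toLie x w - p (toLie x w)) := fun x v w => by
    rw [ricci_leftInvariantTensor hp hgi (connection_koszul hp hs' hg),
      hp.neg_trace_connectionOp hκ hA]
  rw [← hs]
  constructor
  · rintro ⟨c, hc, h⟩
    have h' : ∀ X Y : GroupLieAlgebra (𝓡 m) G,
        (1 / 4) * (κ + (2 * s + 1) ^ 2 * (1 - κ)) *
          (-killingForm ℝ (GroupLieAlgebra (𝓡 m) G)) (p X) (p Y)
        + (1 / 4 - s * A) * (-killingForm ℝ (GroupLieAlgebra (𝓡 m) G)) (X - p X) (Y - p Y) =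
        c * T X Y := by
      intro X Y
      have := h 1 (mulInvariantVectorField X 1) (mulInvariantVectorField Y 1)
      rw [hric, leftInvariantTensor] at this
      simpa only [toLie_mulInvariantVectorField] using this
    refine ⟨c, hc, ?_, ?_⟩
    · have h1 := h' X₀ X₀
      rw [hT, hpX₀, sub_self, map_zero, mul_zero, mul_zero, zero_add, add_zero, ← mul_assoc] at h1
      linarith [mul_right_cancel₀ (hq.pos X₀ hX₀).ne' h1]
    · have h1 := h' Y₀ Y₀
      rw [hT, hpY₀, sub_zero, map_zero, mul_zero, mul_zero, zero_add, add_zero, ← mul_assoc] at h1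
      linarith [mul_right_cancel₀ (hq.pos Y₀ hY₀).ne' h1]
  · rintro ⟨c, hc, h1, h2⟩
    refine ⟨c, hc, fun x v w => ?_⟩
    rw [hric, leftInvariantTensor, hT, h1]
    have h3 : 1 / 4 - s * A = c * Ta := by linarith
    rw [h3]
    ring

end DiagonalMetric

end RicciLie

/-! ### The main theorem. -/

open RicciLie in
theorem proposition4p1 {m l : ℕ} {G : Type*} [TopologicalSpace G] [T2Space G] [CompactSpace G]
    [ChartedSpace (EuclideanSpace ℝ (Fin m)) G] [Group G] [LieGroup (𝓡 m) ∞ G]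
    [LieAlgebra.IsSimple ℝ (GroupLieAlgebra (𝓡 m) G)]
    (K : Subgroup G) [CompactSpace K] [ChartedSpace (EuclideanSpace ℝ (Fin l)) K]
    [LieGroup (𝓡 l) ∞ K]
    (hK_smooth : ContMDiff (𝓡 l) (𝓡 m) ∞ (fun k : K => (k : G)))
    (hK_imm : ∀ k : K,
      Function.Injective (mfderiv (𝓡 l) (𝓡 m) (fun k : K => (k : G)) k))
    [LieAlgebra.IsSimple ℝ (GroupLieAlgebra (𝓡 l) K)]
    (h_irr : AdIrreducible K (aSub K (m := m) (l := l))) :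
    ∃ κ₁ : ℝ,
      (∀ X Y : GroupLieAlgebra (𝓡 l) K,
        killingForm ℝ (GroupLieAlgebra (𝓡 l) K) X Y =
          -κ₁ * Q (inclLie K (m := m) X) (inclLie K (m := m) Y)) ∧
      ∀ (T : LinearMap.BilinForm ℝ (GroupLieAlgebra (𝓡 m) G)) (Ta T₁ : ℝ),
        0 < Ta → 0 < T₁ → IsDiagonal K (m := m) (l := l) T Ta T₁ →
        ((∃ g ∈ metricsMK K (m := m) (l := l), SolvesPrescribedRicci g T) ↔
          (2 * (Module.finrank ℝ (kSub K (m := m) (l := l)) : ℝ) * (1 - κ₁)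
              + (Module.finrank ℝ (aSub K (m := m) (l := l)) : ℝ)) * T₁
            > (Module.finrank ℝ (aSub K (m := m) (l := l)) : ℝ) * Ta * κ₁) ∧
        ∀ g ∈ metricsMK K (m := m) (l := l), ∀ g' ∈ metricsMK K (m := m) (l := l),
          SolvesPrescribedRicci g T → SolvesPrescribedRicci g' T →
          ∃ s : ℝ, 0 < s ∧ g' = s • g := by
  have hq : IsInner (-killingForm ℝ (GroupLieAlgebra (𝓡 m) G)) := isInner_Q
  set φ := inclLieHom hK_smooth with hφdef
  have hφ : Function.Injective φ := hK_imm 1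
  obtain ⟨κ, hκ0, hκ⟩ := exists_killingForm_eq_mul hq hφ
  obtain ⟨e, he⟩ := (hq.comp (φ : GroupLieAlgebra (𝓡 l) K →ₗ[ℝ] GroupLieAlgebra (𝓡 m) G) hφ).exists_frame
  obtain ⟨p, hpdef⟩ : ∃ p : Module.End ℝ (GroupLieAlgebra (𝓡 m) G), p = frameProj
    (-killingForm ℝ (GroupLieAlgebra (𝓡 m) G)) (fun i => φ (e i)) := ⟨_, rfl⟩
  have hp : IsSubalgebraProj p := hpdef ▸ isSubalgebraProj_frameProj hq he
  have hk : ∀ x, p x = x ↔ x ∈ kSub K (m := m) (l := l) := fun x => by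
    rw [hpdef]; exact frameProj_eq_self_iff he x
  have ha : ∀ x, p x = 0 ↔ x ∈ aSub K (m := m) (l := l) := fun x => by
    rw [hpdef]; exact frameProj_eq_zero_iff hq he x
  have hker : LinearMap.ker p = aSub K (m := m) (l := l) := Submodule.ext fun x => ha x
  have hpa : ∀ x, p (x - p x) = 0 := fun x => by rw [map_sub, hp.idem, sub_self]
  have hcomm : ∀ k ∈ K, ∀ x, p (AdEquiv k x) = AdEquiv k (p x) := by
    have hmem : ∀ k ∈ K, ∀ x, p x = x → p (AdEquiv k x) = AdEquiv k x := by
      intro k hkK x hx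
      obtain ⟨y, rfl⟩ := (hk x).mp hx
      rw [hk]
      exact ⟨Ad (⟨k, hkK⟩ : K) y, inclLie_Ad hK_smooth ⟨k, hkK⟩ y⟩
    intro k hkK x
    -- Ad(k) preserves the Killing form and Ad(k⁻¹) preserves 𝔨, so Ad(k) also preserves the
    -- complement 𝔞.
    have h1 : p (AdEquiv k (x - p x)) = 0 := by
      apply hq.eq_zero
      have h3 := hmem k⁻¹ (K.inv_mem hkK) _ (hp.idem (AdEquiv k (x - p x)))
      have h4 : p (AdEquiv k (x - p x)) =
          AdEquiv k (AdEquiv k⁻¹ (p (AdEquiv k (x - p x)))) := (adj_apply_inv k _).symm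
      have h5 : ∀ u v : GroupLieAlgebra (𝓡 m) G,
          (-killingForm ℝ (GroupLieAlgebra (𝓡 m) G)) (AdEquiv k u) (AdEquiv k v) =
          (-killingForm ℝ (GroupLieAlgebra (𝓡 m) G)) u v := fun u v => by
        simp only [LinearMap.neg_apply, LieAlgebra.killingForm_of_equiv_apply]
      rw [hp.selfAdjoint, hp.idem, hq.symm]
      nth_rewrite 1 [h4]
      rw [h5, ← h3, hp.selfAdjoint, hpa, map_zero]
    have h2 := hmem k hkK (p x) (hp.idem x)
    rw [map_sub, map_sub, h2, sub_eq_zero] at h1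
    exact h1
  obtain ⟨A, hA⟩ := exists_casimir hp {θ | ∃ k ∈ K, θ = AdEquiv k}
    (by rintro _ ⟨k, hkK, rfl⟩; exact hcomm k hkK)
    (by rw [hker]; exact h_irr.1)
    (by
      rw [hker]
      intro W hW h
      exact h_irr.2 W hW fun k hkK X hX => h (AdEquiv k) ⟨k, hkK, rfl⟩ X hX)
  have hdiag : ∀ (b : LinearMap.BilinForm ℝ (GroupLieAlgebra (𝓡 m) G)) (α α₁ : ℝ),
      IsDiagonal K (m := m) (l := l) b α α₁ ↔ ∀ v w, b v w =
        α * (-killingForm ℝ (GroupLieAlgebra (𝓡 m) G)) (v - p v) (w - p w)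
        + α₁ * (-killingForm ℝ (GroupLieAlgebra (𝓡 m) G)) (p v) (p w) := by
    intro b α α₁
    constructor
    · intro h v w
      have hv : b v w = b ((v - p v) + p v) ((w - p w) + p w) := by
        rw [sub_add_cancel, sub_add_cancel]
      have h1 := h.on_a _ ((ha _).mp (hpa v)) _ ((ha _).mp (hpa w))
      have h2 := h.on_k _ ((hk _).mp (hp.idem v)) _ ((hk _).mp (hp.idem w))
      have h3 := h.a_k _ ((ha _).mp (hpa v)) _ ((hk _).mp (hp.idem w))
      have h4 := h.k_a _ ((hk _).mp (hp.idem v)) _ ((ha _).mp (hpa w))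
      rw [hv, map_add b, LinearMap.add_apply, map_add (b (v - p v)), map_add (b (p v)), h1, h2,
        h3, h4, add_zero, zero_add]
      rfl
    · intro h
      refine ⟨fun X hX Y hY => ?_, fun X hX Y hY => ?_, fun X hX Y hY => ?_,
        fun X hX Y hY => ?_⟩
      · rw [h, (ha X).mpr hX, (ha Y).mpr hY, map_zero, sub_zero, sub_zero, mul_zero, add_zero]
        rfl
      · rw [h, (hk X).mpr hX, (hk Y).mpr hY, sub_self, sub_self, map_zero, mul_zero, zero_add]
        rfl
      · rw [h, (ha X).mpr hX, (hk Y).mpr hY, sub_self, map_zero, map_zero, LinearMap.zero_apply]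
        simp
      · rw [h, (hk X).mpr hX, (ha Y).mpr hY, sub_self, map_zero, map_zero, LinearMap.zero_apply]
        simp
  obtain ⟨Y₀, hY₀a, hY₀⟩ := Submodule.exists_mem_ne_zero_of_ne_bot h_irr.1
  have hpY₀ := (ha Y₀).mpr hY₀a
  obtain ⟨X, hX⟩ : ∃ X : GroupLieAlgebra (𝓡 l) K, X ≠ 0 := by
    by_contra! h
    exact LieAlgebra.IsSimple.non_abelian ℝ (L := GroupLieAlgebra (𝓡 l) K) ⟨fun x y => h _⟩
  have hX₀ : φ X ≠ 0 := fun h => hX (hφ (h.trans (map_zero φ).symm))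
  have hpX₀ : p (φ X) = φ X := (hk _).mpr ⟨X, rfl⟩
  have hκ1 : κ < 1 := killingForm_ratio_lt_one hq hφ he hκ hY₀ (hpdef ▸ hpY₀)
  have hdim := casimir_mul_finrank hq he hκ hpdef hA
  rw [hker] at hdim
  change A * _ = (1 - κ) * (Module.finrank ℝ (kSub K (m := m) (l := l)) : ℝ) at hdim
  have hn : 0 < (Module.finrank ℝ (aSub K (m := m) (l := l)) : ℝ) := by
    have : Nontrivial (aSub K (m := m) (l := l)) := Submodule.nontrivial_iff_ne_bot.mpr h_irr.1
    exact_mod_cast Module.finrank_pos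
  have hd : 0 < (Module.finrank ℝ (kSub K (m := m) (l := l)) : ℝ) := by
    have : Nontrivial (kSub K (m := m) (l := l)) :=
      ⟨⟨⟨φ X, ⟨X, rfl⟩⟩, 0, fun h => hX₀ (congrArg Subtype.val h)⟩⟩
    exact_mod_cast Module.finrank_pos
  have hA0 : 0 < A := by
    have h1 : 0 < A * (Module.finrank ℝ (aSub K (m := m) (l := l)) : ℝ) := by
      rw [hdim]
      exact mul_pos (sub_pos.mpr hκ1) hd
    exact pos_of_mul_pos_left h1 hn.le
  have hκtr : ∀ v w, p v = v → p w = w → LinearMap.trace ℝ _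
      (p * (LieAlgebra.ad ℝ _ v * LieAlgebra.ad ℝ _ w)) =
        κ * killingForm ℝ (GroupLieAlgebra (𝓡 m) G) v w := by
    intro v w hv hw
    obtain ⟨x, rfl⟩ := (hk v).mp hv
    obtain ⟨y, rfl⟩ := (hk w).mp hw
    rw [hpdef]
    exact (trace_frameProj_mul_ad_map he x y).trans (hκ x y)
  refine ⟨κ, fun X Y => ?_, fun T Ta T₁ hTa hT₁ hT => ?_⟩
  · rw [hκ, Q, LinearMap.neg_apply, LinearMap.neg_apply, neg_mul_neg]
    rfl
  have hsolve : ∀ (g : LinearMap.BilinForm ℝ (GroupLieAlgebra (𝓡 m) G)) (α α₁ : ℝ), 0 < α →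
      0 < α₁ → IsDiagonal K (m := m) (l := l) g α α₁ → (SolvesPrescribedRicci g T ↔
        Ta * (κ + (α₁ / α) ^ 2 * (1 - κ)) = T₁ * (1 + 2 * A - 2 * A * (α₁ / α))) := by
    intro g α α₁ hα hα₁ hg
    rw [solvesPrescribedRicci_iff hp hκtr hA hX₀ hpX₀ hY₀ hpY₀ hα hα₁ ((hdiag _ _ _).mp hg)
      ((hdiag _ _ _).mp hT)]
    constructor
    · rintro ⟨c, -, h1, h2⟩
      rw [h1, h2]; ring
    · intro h
      have hpos : 0 < κ + (α₁ / α) ^ 2 * (1 - κ) := by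
        have := sub_pos.mpr hκ1
        positivity
      generalize α₁ / α = y at h hpos ⊢
      -- The equation on 𝔨 determines c, and c > 0 is automatic because 0 < κ < 1.
      refine ⟨(κ + y ^ 2 * (1 - κ)) / (4 * T₁), by positivity, by field_simp, ?_⟩
      field_simp
      linarith
  constructor
  · have hcond : (2 * (Module.finrank ℝ (kSub K (m := m) (l := l)) : ℝ) * (1 - κ)
              + (Module.finrank ℝ (aSub K (m := m) (l := l)) : ℝ)) * T₁
            > (Module.finrank ℝ (aSub K (m := m) (l := l)) : ℝ) * Ta * κ ↔
        Ta * κ < T₁ * (1 + 2 * A) := by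
      have h1 : (2 * (Module.finrank ℝ (kSub K (m := m) (l := l)) : ℝ) * (1 - κ)
              + (Module.finrank ℝ (aSub K (m := m) (l := l)) : ℝ)) * T₁ =
          (Module.finrank ℝ (aSub K (m := m) (l := l)) : ℝ) * (T₁ * (1 + 2 * A)) := by
        linear_combination (-2 * T₁) * hdim
      rw [gt_iff_lt, h1, mul_assoc, mul_lt_mul_iff_right₀ hn]
    rw [hcond, ← exists_ratio_iff hκ0 hκ1 hA0 hTa hT₁]
    constructor
    · rintro ⟨g, ⟨α, α₁, hα, hα₁, hg⟩, h⟩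
      exact ⟨α₁ / α, div_pos hα₁ hα, (hsolve g α α₁ hα hα₁ hg).mp h⟩
    · rintro ⟨x, hx, h⟩
      let q := -killingForm ℝ (GroupLieAlgebra (𝓡 m) G)
      let g : LinearMap.BilinForm ℝ (GroupLieAlgebra (𝓡 m) G) :=
        q.compl₁₂ (LinearMap.id - p) (LinearMap.id - p) + x • q.compl₁₂ p p
      have hg : IsDiagonal K (m := m) (l := l) g 1 x := by
        rw [hdiag]
        intro v w
        rw [one_mul]
        rfl
      exact ⟨g, ⟨1, x, one_pos, hx, hg⟩, (hsolve g 1 x one_pos hx hg).mpr (by simpa using h)⟩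
  · rintro g ⟨α, α₁, hα, hα₁, hg⟩ g' ⟨α', α₁', hα', hα₁', hg'⟩ h h'
    have hxy := ratio_unique hκ1 hA0 hTa hT₁ (div_pos hα₁ hα) (div_pos hα₁' hα')
      ((hsolve g α α₁ hα hα₁ hg).mp h) ((hsolve g' α' α₁' hα' hα₁' hg').mp h')
    refine ⟨α' / α, div_pos hα' hα, ?_⟩
    ext v w
    -- Equal ratios α₁/α and α₁'/α' mean that the same factor rescales both summands.
    have h1 : α₁' = α' / α * α₁ := by
      field_simp at hxy ⊢
      linarith
    rw [LinearMap.smul_apply, LinearMap.smul_apply, (hdiag _ _ _).mp hg', (hdiag _ _ _).mp hg, h1,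
      smul_eq_mul]
    field_simp
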